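/- **Conventions.** $k$ is a field and all schemes are of finite type over $k$. For a closed embedding $Y\subset X$ with ideal sheaf $\mathcal J_{Y,X}\subset\mathcal O_X$, the blow-up and the symmetric blow-up of $X$ along $Y$ are $$B\ell_YX=\mathrm{Proj}\big(\mathrm{Rees}_{\mathcal O_X}(\mathcal J_{Y,X})\big),\qquad sB\ell_YX=\mathrm{Proj}\big(\mathrm{Sym}_{\mathcal O_X}(\mathcal J_{Y,X})\big),\qquad \mathrm{Rees}_{\mathcal O_X}(\mathcal J)=\bigoplus_{d\ge0}\mathcal J^d .$$ For closed embeddings $Y\subset X\subset M$ over $k$, put $$\mathrm{qSym}_{X\subset M}(\mathcal J_{Y,X}):=\mathrm{Sym}_{\mathcal O_X}(\mathcal J_{Y,X})\otimes_{\mathrm{Sym}_{\mathcal O_M}(\mathcal J_{Y,M})}\mathrm{Rees}_{\mathcal O_M}(\mathcal J_{Y,M}),$$ a graded quotient algebra of $\mathrm{Sym}_{\mathcal O_X}(\mathcal J_{Y,X})$. As $M$ varies over the schemes of finite type over $k$ containing $X$ as a closed subscheme, these quotients form an inverse system; the quasi-symmetric algebra $\mathrm{qSym}_{\mathcal O_X}(\mathcal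 J_{Y,X})$ is its inverse limit, as a graded $\mathcal O_X$-algebra, and the quasi-symmetric blow-up is $$qB\ell_YX:=\mathrm{Proj}\big(\mathrm{qSym}_{\mathcal O_X}(\mathcal J_{Y,X})\big).$$ Let $M\supset X\supset Y$ be as above. There are canonical morphisms $sB\ell_YX\to sB\ell_YM\leftarrow B\ell_YM$, induced by $\mathrm{Sym}_{\mathcal O_M}(\mathcal J_{Y,M})\to\mathrm{Sym}_{\mathcal O_X}(\mathcal J_{Y,X})$ and $\mathrm{Sym}_{\mathcal O_M}(\mathcal J_{Y,M})\to\mathrm{Rees}_{\mathcal O_M}(\mathcal J_{Y,M})$. A (locally closed) subscheme $\iota:Z\hookrightarrow sB\ell_YX$ is said to *admit an embedding in $B\ell_YM$* if there is an embedding (immersion) $e:Z\hookrightarrow B\ell_YM$ which is compatible with the projections to $X\subset M$ and which agrees with $\iota$ after composition with the canonical morphisms to $sB\ell_YM$. **Corollary.** Let $X$ be a scheme of finite type over $k$ which is isomorphic to a closed subscheme of a nonsingular (that is, smooth over $k$) scheme of finite type over $k$, and let $Y\subset X$ be a closed subscheme. Then the quasi-symmetric algebra $\mathrm{qSym}_{\mathcal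 O_X}(\mathcal J_{Y,X})$ is quasi-coherent, the canonical map $\mathrm{Sym}_{\mathcal O_X}(\mathcal J_{Y,X})\to\mathrm{qSym}_{\mathcal O_X}(\mathcal J_{Y,X})$ induces a closed embedding $qB\ell_YX\hookrightarrow sB\ell_YX$, and $qB\ell_YX$ is the largest subscheme of $sB\ell_YX$ which admits an embedding in $B\ell_YM$ for some scheme $M$ containing $X$ as a closed subscheme. That is: 1. the subscheme $qB\ell_YX$ of $sB\ell_YX$ admits an embedding in $B\ell_YM$ for some scheme $M$ of finite type over $k$ containing $X$ as a closed subscheme; 2. if a subscheme $Z$ of $sB\ell_YX$ admits an embedding in $B\ell_YM$ for some scheme $M$ of finite type over $k$ containing $X$ as a closed subscheme, then $Z$ is a subscheme of $qB\ell_YX$, that is, $Z\hookrightarrow sB\ell_YX$ factors through $qB\ell_YX\hookrightarrow sB\ell_YX$. -/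

import Mathlib

open CategoryTheory AlgebraicGeometry

universe u

noncomputable section
namespace QSym

open DirectSum

section Algebra
variable {R : Type*} [CommRing R]

section Sym
variable (R) (N : Type*) [AddCommGroup N] [Module R N]

/-- The degree `d` part of the symmetric algebra: the span of the `d`-fold products of elements
of the module. -/
def symGrading (d : ℕ) : Submodule R (SymmetricAlgebra R N) :=
  LinearMap.range (SymmetricAlgebra.ι R N) ^ d

instance symGrading.gradedMonoid : SetLike.GradedMonoid (symGrading R N) :=
  Submodule.nat_power_gradedMonoid _

lemma ι_mem_symGrading (x : N) : SymmetricAlgebra.ι R N x ∈ symGrading R N 1 := by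
  rw [symGrading, pow_one]; exact LinearMap.mem_range_self _ x

/-- The map from the module to the external sum of the graded parts. -/
def symGradedι : N →ₗ[R] ⨁ d : ℕ, symGrading R N d :=
  DirectSum.lof R ℕ (fun d => symGrading R N d) 1 ∘ₗ
    (SymmetricAlgebra.ι R N).codRestrict _ fun x => ι_mem_symGrading R N x

instance symGrading.gradedAlgebra : GradedAlgebra (symGrading R N) :=
  GradedAlgebra.ofAlgHom _ (SymmetricAlgebra.lift (symGradedι R N))
    (by
      apply SymmetricAlgebra.algHom_ext
      ext x
      simp [symGradedι, DirectSum.lof_eq_of, DirectSum.coeAlgHom_of])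
    (by
      rintro i ⟨x, hx⟩
      unfold symGrading at hx
      dsimp only [DirectSum.lof_eq_of]
      induction hx using Submodule.pow_induction_on_left' with
      | algebraMap r =>
        rw [AlgHom.commutes, DirectSum.algebraMap_apply]; rfl
      | add x y i hx hy ihx ihy =>
        rw [map_add, ihx, ihy, ← map_add]; rfl
      | mem_mul m hm i x hx ih =>
        obtain ⟨_, rfl⟩ := hm
        rw [map_mul, ih, SymmetricAlgebra.lift_ι_apply]
        simp only [symGradedι, LinearMap.comp_apply, DirectSum.lof_eq_of]
        rw [DirectSum.of_mul_of]
        exact DirectSum.of_eq_of_gradedMonoid_eq (Sigma.subtype_ext (add_comm _ _) rfl))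
end Sym

section Rees
variable (I : Ideal R)

/-- The degree `d` part of the Rees algebra: the elements `r t ^ d` with `r ∈ I ^ d`. -/
def reesGrading (d : ℕ) : Submodule R (reesAlgebra I) where
  carrier := {f | ∀ n, n ≠ d → (f : Polynomial R).coeff n = 0}
  add_mem' hf hg n hn := by simp [hf n hn, hg n hn]
  zero_mem' n _ := by simp
  smul_mem' r f hf n hn := by simp [hf n hn]

lemma mem_reesGrading_iff {d : ℕ} {f : reesAlgebra I} :
    f ∈ reesGrading I d ↔ (f : Polynomial R) = Polynomial.monomial d ((f : Polynomial R).coeff d) := by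
  constructor
  · intro h
    ext n
    by_cases hn : n = d
    · subst hn; simp
    · rw [h n hn, Polynomial.coeff_monomial, if_neg (Ne.symm hn)]
  · intro h n hn
    rw [h, Polynomial.coeff_monomial, if_neg (Ne.symm hn)]

/-- The degree `d` component of an element of the Rees algebra. -/
def reesComponent (d : ℕ) : reesAlgebra I →+ reesGrading I d where
  toFun f := ⟨⟨Polynomial.monomial d ((f : Polynomial R).coeff d),
    reesAlgebra.monomial_mem.mpr (f.2 d)⟩, by
      intro n hn; simp [Polynomial.coeff_monomial, Ne.symm hn]⟩
  map_zero' := by ext; simp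
  map_add' f g := by ext; simp

instance reesGrading.gradedMonoid : SetLike.GradedMonoid (reesGrading I) where
  one_mem := by
    intro n hn
    simp [Polynomial.coeff_one, hn]
  mul_mem := by
    intro i j f g hf hg
    rw [mem_reesGrading_iff] at hf hg
    intro n hn
    rw [MulMemClass.coe_mul, hf, hg, Polynomial.monomial_mul_monomial, Polynomial.coeff_monomial,
      if_neg (Ne.symm hn)]

lemma reesComponent_coeAddMonoidHom (d : ℕ) (x : ⨁ d, reesGrading I d) :
    reesComponent I d (DirectSum.coeAddMonoidHom (reesGrading I) x) = x d := by
  induction x using DirectSum.induction_on with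
  | zero => simp
  | of i x =>
    rw [DirectSum.coeAddMonoidHom_of]
    by_cases h : i = d
    · subst h
      rw [DirectSum.of_eq_same]
      ext1; ext1
      exact ((mem_reesGrading_iff I).mp x.2).symm
    · rw [DirectSum.of_eq_of_ne _ _ _ (Ne.symm h)]
      ext1; ext1
      simp [reesComponent, x.2 d (Ne.symm h)]
  | add x y hx hy => rw [map_add, map_add, hx, hy]; rfl

lemma coeAddMonoidHom_sum_reesComponent (f : reesAlgebra I) :
    DirectSum.coeAddMonoidHom (reesGrading I) (∑ d ∈ (f : Polynomial R).support,
      DirectSum.of (fun d => reesGrading I d) d (reesComponent I d f)) = f := by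
  ext1
  simp only [map_sum, DirectSum.coeAddMonoidHom_of, AddSubmonoidClass.coe_finsetSum]
  exact ((f : Polynomial R).as_sum_support).symm

instance reesGrading.gradedAlgebra : GradedAlgebra (reesGrading I) where
  decompose' f := ∑ d ∈ (f : Polynomial R).support,
    DirectSum.of (fun d => reesGrading I d) d (reesComponent I d f)
  left_inv f := coeAddMonoidHom_sum_reesComponent I f
  right_inv x := by
    ext1 d
    rw [← reesComponent_coeAddMonoidHom, coeAddMonoidHom_sum_reesComponent,
      reesComponent_coeAddMonoidHom]
end Rees

section Maps
variable {S : Type*} [CommRing S]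

lemma symmetricAlgebra_ringHom_ext {N : Type*} [AddCommGroup N] [Module R N]
    {f g : SymmetricAlgebra R N →+* S}
    (h₀ : ∀ r, f (algebraMap R _ r) = g (algebraMap R _ r))
    (h₁ : ∀ x, f (SymmetricAlgebra.ι R N x) = g (SymmetricAlgebra.ι R N x)) : f = g := by
  refine RingHom.ext fun x => ?_
  induction x using SymmetricAlgebra.induction with
  | algebraMap r => exact h₀ r
  | ι x => exact h₁ x
  | mul a b ha hb => rw [map_mul, map_mul, ha, hb]
  | add a b ha hb => rw [map_add, map_add, ha, hb]

/-- A ring map `A → B` and an additive map `N → B` semilinear over it induce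
`Sym_A N → B`. -/
def symLift {N : Type*} [AddCommGroup N] [Module R N] (φ : R →+* S) (g : N →+ S)
    (hg : ∀ (r : R) (x : N), g (r • x) = φ r * g x) : SymmetricAlgebra R N →+* S :=
  letI := φ.toAlgebra
  (SymmetricAlgebra.lift (R := R) (A := S)
    { g with map_smul' := fun r x => (hg r x).trans (Algebra.smul_def r (g x)).symm }).toRingHom

section
variable {N : Type*} [AddCommGroup N] [Module R N] (φ : R →+* S) (g : N →+ S)
    (hg : ∀ (r : R) (x : N), g (r • x) = φ r * g x)
@[simp]
lemma symLift_algebraMap (r : R) : symLift φ g hg (algebraMap _ _ r) = φ r := by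
  let := φ.toAlgebra
  exact AlgHom.commutes (SymmetricAlgebra.lift (R := R) (A := S) _) r

@[simp]
lemma symLift_ι (x : N) : symLift φ g hg (SymmetricAlgebra.ι R N x) = g x := by
  let := φ.toAlgebra
  exact SymmetricAlgebra.lift_ι_apply (R := R) (A := S) _ x

lemma symLift_mem {σ : Type*} [SetLike σ S] [AddSubmonoidClass σ S] (𝒮 : ℕ → σ)
    [SetLike.GradedMonoid 𝒮] (h₀ : ∀ r, φ r ∈ 𝒮 0) (h₁ : ∀ x, g x ∈ 𝒮 1) {d : ℕ}
    {x : SymmetricAlgebra R N} (hx : x ∈ symGrading R N d) : symLift φ g hg x ∈ 𝒮 d := by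
  unfold symGrading at hx
  induction hx using Submodule.pow_induction_on_left' with
  | algebraMap r => simpa using h₀ r
  | add x y i hx hy ihx ihy => rw [map_add]; exact add_mem ihx ihy
  | mem_mul m hm i x hx ih =>
    obtain ⟨y, rfl⟩ := hm
    rw [map_mul, symLift_ι, Nat.succ_eq_one_add]
    exact SetLike.mul_mem_graded (h₁ y) ih
end

lemma algebraMap_mem_zero {A : Type*} [CommRing A] [Algebra R A] (𝒜 : ℕ → Submodule R A)
    [SetLike.GradedMonoid 𝒜] (r : R) : algebraMap R A r ∈ 𝒜 0 := by
  rw [Algebra.algebraMap_eq_smul_one]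
  exact Submodule.smul_mem _ _ SetLike.GradedOne.one_mem

variable (φ : R →+* S) {I : Ideal R} {J : Ideal S} (h : I ≤ J.comap φ)

/-- The additive map `I → J` induced by a ring map carrying `I` into `J`. -/
def idealRes : I →+ J :=
  ((φ : R →+ S).comp I.toAddSubgroup.subtype).codRestrict J (fun x => h x.2)

@[simp] lemma coe_idealRes (x : I) : (idealRes φ h x : S) = φ x := rfl

lemma ι_idealRes_smul (r : R) (x : I) :
    (SymmetricAlgebra.ι S J).toAddMonoidHom.comp (idealRes φ h) (r • x) =
      (algebraMap S (SymmetricAlgebra S J)).comp φ r *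
        (SymmetricAlgebra.ι S J).toAddMonoidHom.comp (idealRes φ h) x := by
  have : idealRes φ h (r • x) = φ r • idealRes φ h x := by ext; simp
  simp only [AddMonoidHom.comp_apply, this, RingHom.comp_apply, ← Algebra.smul_def]
  exact (SymmetricAlgebra.ι S J).map_smul _ _

/-- The map `Sym_R(I) → Sym_S(J)` induced by a ring map `R → S` carrying `I` into `J`. -/
def symMap : symGrading R I →+*ᵍ symGrading S J where
  toRingHom := symLift (N := I) ((algebraMap S (SymmetricAlgebra S J)).comp φ)
    ((SymmetricAlgebra.ι S J).toAddMonoidHom.comp (idealRes φ h)) (ι_idealRes_smul φ h)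
  map_mem {d x} hx := by
    have h0 : ∀ r, (algebraMap S (SymmetricAlgebra S J)).comp φ r ∈ symGrading S J 0 :=
      fun r => algebraMap_mem_zero (symGrading S J) _
    have h1 : ∀ x, (SymmetricAlgebra.ι S J).toAddMonoidHom.comp (idealRes φ h) x ∈
        symGrading S J 1 := fun x => ι_mem_symGrading S J _
    exact symLift_mem _ _ (ι_idealRes_smul φ h) (symGrading S J) h0 h1 hx

@[simp] lemma symMap_algebraMap (r : R) :
    symMap φ h (algebraMap R _ r) = algebraMap S _ (φ r) :=
  symLift_algebraMap _ _ (ι_idealRes_smul φ h) r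

@[simp] lemma symMap_ι (x : I) :
    symMap φ h (SymmetricAlgebra.ι R I x) = SymmetricAlgebra.ι S J (idealRes φ h x) :=
  symLift_ι _ _ (ι_idealRes_smul φ h) x

/-- The map `Rees_R(I) → Rees_S(J)` induced by a ring map `R → S` carrying `I` into `J`. -/
def reesMap : reesGrading I →+*ᵍ reesGrading J where
  toRingHom := ((Polynomial.mapRingHom φ).comp (reesAlgebra I).val.toRingHom).codRestrict
    (reesAlgebra J).toSubring (fun f n => by
      have h1 : I.map φ ≤ J := Ideal.map_le_iff_le_comap.mpr h
      have := Ideal.pow_right_mono h1 n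
      rw [← Ideal.map_pow] at this
      have := this (Ideal.mem_map_of_mem φ (f.2 n))
      change (Polynomial.map φ f.1).coeff n ∈ J ^ n
      rwa [Polynomial.coeff_map])
  map_mem {d f} hf n hn := by
    change (Polynomial.map φ f.1).coeff n = 0
    rw [Polynomial.coeff_map, hf n hn, map_zero]

@[simp] lemma coe_reesMap (f : reesAlgebra I) :
    (reesMap φ h f : Polynomial S) = Polynomial.map φ f := rfl

variable (I) in
/-- The inclusion of `I` as the degree one part of the Rees algebra. -/
def reesι : I →+ reesAlgebra I where
  toFun x := ⟨Polynomial.monomial 1 (x : R), reesAlgebra.monomial_mem.mpr (by simp)⟩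
  map_zero' := by ext1; simp
  map_add' x y := by ext1; simp

lemma reesι_smul (r : R) (x : I) :
    reesι I (r • x) = algebraMap R (reesAlgebra I) r * reesι I x := by
  ext1; simp [reesι, Polynomial.C_mul_monomial]

variable (I) in
/-- The canonical surjection `Sym_R(I) → Rees_R(I)`. -/
def symToRees : symGrading R I →+*ᵍ reesGrading I where
  toRingHom := symLift (N := I) (algebraMap R (reesAlgebra I)) (reesι I) reesι_smul
  map_mem hx := symLift_mem _ _ _ _ (fun r => algebraMap_mem_zero _ _)
    (fun x n hn => by simp [reesι, Polynomial.coeff_monomial, Ne.symm hn]) hx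

@[simp] lemma symToRees_ι (x : I) :
    symToRees I (SymmetricAlgebra.ι R I x) = reesι I x := symLift_ι _ _ reesι_smul x

@[simp] lemma symToRees_algebraMap (r : R) :
    symToRees I (algebraMap R _ r) = algebraMap R _ r := symLift_algebraMap _ _ reesι_smul r

end Maps
section Localization
variable {S : Type*} [CommRing S]

/-- `ψ : R → S` exhibits `S` as the localization of `R` at (the powers of) `f`. -/
def IsAwayMap (ψ : R →+* S) (f : R) : Prop :=
  (Submonoid.powers f).IsLocalizationMap ψ

lemma isAwayMap_iff {ψ : R →+* S} {f : R} : IsAwayMap ψ f ↔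
    IsUnit (ψ f) ∧ (∀ z, ∃ (x : R) (n : ℕ), z * ψ f ^ n = ψ x) ∧
      ∀ x, ψ x = 0 → ∃ n : ℕ, f ^ n * x = 0 := by
  constructor
  · rintro ⟨h1, h2, h3⟩
    refine ⟨h1 ⟨f, 1, pow_one f⟩, fun z => ?_, fun x hx => ?_⟩
    · obtain ⟨⟨x, _, n, rfl⟩, hx⟩ := h2 z
      exact ⟨x, n, by simpa using hx⟩
    · obtain ⟨⟨_, n, rfl⟩, h⟩ := h3 (x := x) (y := 0) (by simpa using hx)
      exact ⟨n, by simpa using h⟩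
  · rintro ⟨h1, h2, h3⟩
    refine ⟨?_, fun z => ?_, fun {x y} hxy => ?_⟩
    · rintro ⟨_, n, rfl⟩
      simpa using h1.pow n
    · obtain ⟨x, n, hx⟩ := h2 z
      exact ⟨⟨x, _, n, rfl⟩, by simpa using hx⟩
    · obtain ⟨n, hn⟩ := h3 (x - y) (by simpa [sub_eq_zero] using hxy)
      exact ⟨⟨_, n, rfl⟩, by simpa [mul_sub, sub_eq_zero] using hn⟩

variable {φ : R →+* S} {f : R} {I : Ideal R} {J : Ideal S} (h : I ≤ J.comap φ)

lemma IsAwayMap.exists_mem_of_mem_map (hφ : IsAwayMap φ f) {z : S} (hz : z ∈ I.map φ) :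
    ∃ x ∈ I, ∃ n : ℕ, z * φ f ^ n = φ x := by
  let := φ.toAlgebra
  have : IsLocalization (Submonoid.powers f) S := ⟨hφ⟩
  obtain ⟨⟨⟨x, hx⟩, ⟨_, n, rfl⟩⟩, e⟩ :=
    (IsLocalization.mem_map_algebraMap_iff (Submonoid.powers f) S).mp hz
  exact ⟨x, hx, n, by simpa using! e⟩

lemma isAwayMap_reesMap (hφ : IsAwayMap φ f) (hJ : I.map φ = J) :
    IsAwayMap (reesMap φ h).toRingHom (algebraMap R (reesAlgebra I) f) := by
  have hφ' := isAwayMap_iff.mp hφ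
  have key (r : R) : reesMap φ h (algebraMap R _ r) = algebraMap S _ (φ r) := by
    ext1; simp
  refine isAwayMap_iff.mpr ⟨?_, fun z => ?_, fun x hx => ?_⟩
  · change IsUnit (reesMap φ h (algebraMap R _ f))
    rw [key]; exact hφ'.1.map _
  · change ∃ x n, z * (reesMap φ h (algebraMap R _ f)) ^ n = reesMap φ h x
    rw [key]
    induction z using DirectSum.Decomposition.inductionOn (reesGrading J) with
    | zero => exact ⟨0, 0, by simp⟩
    | @homogeneous d m =>
      obtain ⟨⟨m, hm⟩, hmd⟩ := m
      have h2 := hm d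
      rw [← hJ, ← Ideal.map_pow] at h2
      obtain ⟨x, hx, n, e⟩ := hφ.exists_mem_of_mem_map h2
      refine ⟨⟨Polynomial.monomial d x, reesAlgebra.monomial_mem.mpr hx⟩, n, ?_⟩
      ext1
      have := (mem_reesGrading_iff J).mp hmd
      simp only [coe_reesMap, Polynomial.map_monomial, ← e]
      simp only [MulMemClass.coe_mul, Subalgebra.coe_algebraMap,
        Polynomial.algebraMap_apply, Algebra.algebraMap_self, RingHom.id_apply, ← map_pow]
      have this : m = Polynomial.monomial d (m.coeff d) := this
      conv_lhs => rw [this]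
      rw [Polynomial.monomial_mul_C]
    | add a b ha hb =>
      obtain ⟨x, n, hx⟩ := ha
      obtain ⟨y, m, hy⟩ := hb
      refine ⟨x * algebraMap R _ f ^ m + y * algebraMap R _ f ^ n, n + m, ?_⟩
      rw [map_add, map_mul, map_mul, ← hx, ← hy, map_pow, map_pow, key]
      ring
  · have hx' : ∀ d, ∃ n : ℕ, f ^ n * (x : Polynomial R).coeff d = 0 := by
      intro d
      apply hφ'.2.2
      have : (reesMap φ h x : Polynomial S) = 0 := by
        rw [show reesMap φ h x = 0 from hx]; rfl
      rw [coe_reesMap] at this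
      rw [← Polynomial.coeff_map, this, Polynomial.coeff_zero]
    choose n hn using hx'
    refine ⟨(x : Polynomial R).support.sup n, ?_⟩
    ext1
    rw [← map_pow]
    ext d
    simp only [MulMemClass.coe_mul, Subalgebra.coe_algebraMap,
      Polynomial.algebraMap_apply, Algebra.algebraMap_self, RingHom.id_apply,
      Polynomial.coeff_C_mul, ZeroMemClass.coe_zero, Polynomial.coeff_zero]
    by_cases hd : d ∈ (x : Polynomial R).support
    · obtain ⟨c, hc⟩ := Nat.exists_eq_add_of_le (Finset.le_sup (f := n) hd)
      rw [hc, pow_add, mul_right_comm, hn, zero_mul]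
    · rw [Polynomial.notMem_support_iff.mp hd, mul_zero]

lemma isAwayMap_symMap (hφ : IsAwayMap φ f) (hJ : I.map φ = J) :
    IsAwayMap (symMap φ h).toRingHom (algebraMap R (SymmetricAlgebra R I) f) := by
  have hφ' := isAwayMap_iff.mp hφ
  refine isAwayMap_iff.mpr ⟨?_, fun z => ?_, fun x hx => ?_⟩
  · change IsUnit (symMap φ h (algebraMap R _ f))
    rw [symMap_algebraMap]; exact hφ'.1.map _
  · change ∃ x n, z * (symMap φ h (algebraMap R _ f)) ^ n = symMap φ h x
    rw [symMap_algebraMap]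
    induction z using SymmetricAlgebra.induction with
    | algebraMap r =>
      obtain ⟨x, n, hx⟩ := hφ'.2.1 r
      exact ⟨algebraMap R _ x, n, by rw [symMap_algebraMap, ← hx, map_mul, map_pow]⟩
    | ι z =>
      obtain ⟨x, hx, n, e⟩ := hφ.exists_mem_of_mem_map (hJ.symm ▸ z.2 : (z : S) ∈ I.map φ)
      refine ⟨SymmetricAlgebra.ι R I ⟨x, hx⟩, n, ?_⟩
      rw [symMap_ι, ← map_pow, mul_comm, ← Algebra.smul_def, ← map_smul]
      congr 1
      ext1
      simp [← e, mul_comm]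
    | mul a b ha hb =>
      obtain ⟨x, n, hx⟩ := ha
      obtain ⟨y, m, hy⟩ := hb
      exact ⟨x * y, n + m, by rw [map_mul, ← hx, ← hy]; ring⟩
    | add a b ha hb =>
      obtain ⟨x, n, hx⟩ := ha
      obtain ⟨y, m, hy⟩ := hb
      refine ⟨x * algebraMap R _ f ^ m + y * algebraMap R _ f ^ n, n + m, ?_⟩
      rw [map_add, map_mul, map_mul, ← hx, ← hy, map_pow, map_pow, symMap_algebraMap]
      ring
  · let := φ.toAlgebra
    have : IsLocalization (Submonoid.powers f) S := ⟨hφ⟩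
    subst hJ
    let a : SymmetricAlgebra R I := algebraMap R _ f
    let B := Localization.Away a
    have hR (r : R) : algebraMap R B r = algebraMap (SymmetricAlgebra R I) B (algebraMap R _ r) :=
      IsScalarTower.algebraMap_apply R (SymmetricAlgebra R I) B r
    have hu : IsUnit (algebraMap R B f) := by
      rw [hR]; exact IsLocalization.Away.algebraMap_isUnit (S := B) a
    have hB : ∀ y : Submonoid.powers f, IsUnit (algebraMap R B y) := by
      rintro ⟨_, n, rfl⟩
      simpa using hu.pow n
    let σ : S →+* B := IsLocalization.lift (M := Submonoid.powers f) hB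
    have hσ (r : R) : σ (φ r) = algebraMap R B r := IsLocalization.lift_eq hB r
    have hE : ∀ y : Submonoid.powers f, IsUnit (algebraMap R (Module.End R B) y) := by
      intro y
      have : algebraMap R (Module.End R B) y = Algebra.lmul R B (algebraMap R B y) := by
        ext b
        simp [Algebra.smul_def]
      rw [this]
      exact (hB y).map _
    let l : I →ₗ[R] B := (Algebra.linearMap (SymmetricAlgebra R I) B).restrictScalars R ∘ₗ
      SymmetricAlgebra.ι R I
    let g : I.map (algebraMap R S) →ₗ[R] B :=
      IsLocalizedModule.lift (Submonoid.powers f) (Algebra.idealMap S I) l hE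
    have hg (x : I) : g (Algebra.idealMap S I x) = l x :=
      IsLocalizedModule.lift_apply (Submonoid.powers f) (Algebra.idealMap S I) l hE x
    have hgs (s : S) (x : I.map (algebraMap R S)) : g (s • x) = σ s * g x := by
      obtain ⟨r, n, e⟩ := hφ'.2.1 s
      have h1 : f ^ n • g (s • x) = r • g x := by
        rw [← map_smul, ← map_smul]
        congr 1
        ext1
        have e' : algebraMap R S f ^ n * s = algebraMap R S r := by rw [mul_comm]; exact e
        change f ^ n • (s * (x : S)) = r • (x : S)
        rw [Algebra.smul_def, Algebra.smul_def, ← mul_assoc, map_pow, e']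
      have h2 : algebraMap R B f ^ n * g (s • x) = algebraMap R B f ^ n * (σ s * g x) := by
        rw [← map_pow, ← Algebra.smul_def, h1, Algebra.smul_def, ← hσ r, ← e, map_mul, map_pow, hσ,
          map_pow]
        ring
      exact (hu.pow n).mul_left_cancel h2
    let θ : SymmetricAlgebra S (I.map (algebraMap R S)) →+* B := symLift σ g.toAddMonoidHom hgs
    have hθ : θ.comp (symMap φ h).toRingHom = algebraMap (SymmetricAlgebra R I) B := by
      refine symmetricAlgebra_ringHom_ext (fun r => ?_) (fun x => ?_)
      · change θ (symMap φ h _) = _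
        rw [symMap_algebraMap]
        exact (symLift_algebraMap σ g.toAddMonoidHom hgs (φ r)).trans ((hσ r).trans (hR r))
      · change θ (symMap φ h _) = _
        rw [symMap_ι]
        exact (symLift_ι σ g.toAddMonoidHom hgs _).trans (hg x)
    have : algebraMap (SymmetricAlgebra R I) B x = 0 := by
      rw [← hθ, RingHom.comp_apply, hx, map_zero]
    obtain ⟨⟨_, n, rfl⟩, hn⟩ := (IsLocalization.map_eq_zero_iff (Submonoid.powers a) B x).mp this
    exact ⟨n, hn⟩
end Localization

section Away
variable {R S A B : Type*} [CommRing R] [CommRing S] [CommRing A] [CommRing B]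
  [Algebra R A] [Algebra S B] {𝒜 : ℕ → Submodule R A} {ℬ : ℕ → Submodule S B}
  [GradedAlgebra 𝒜] [GradedAlgebra ℬ] (ψ : 𝒜 →+*ᵍ ℬ) {f : R}

lemma isAwayMap_homogeneous (h : IsAwayMap ψ.toRingHom (algebraMap R A f)) {i : ℕ} {b : B}
    (hb : b ∈ ℬ i) : ∃ (x : A) (n : ℕ), x ∈ 𝒜 i ∧ b * ψ (algebraMap R A f) ^ n = ψ x := by
  have h' := isAwayMap_iff.mp h
  obtain ⟨x, n, e⟩ := h'.2.1 b
  change b * (ψ (algebraMap R A f)) ^ n = ψ x at e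
  have h0 : ψ (algebraMap R A f) ^ n ∈ ℬ 0 := by
    simpa using SetLike.pow_mem_graded n (ψ.2 (algebraMap_mem_zero 𝒜 f))
  have hm : b * ψ (algebraMap R A f) ^ n ∈ ℬ i := by
    simpa using SetLike.mul_mem_graded hb h0
  refine ⟨DirectSum.decompose 𝒜 x i, n, Subtype.prop _, ?_⟩
  rw [GradedRingHom.map_directSumDecompose, ← e, DirectSum.decompose_of_mem_same ℬ hm]

open HomogeneousIdeal in
lemma irrelevant_le_of_isAwayMap (h : IsAwayMap ψ.toRingHom (algebraMap R A f)) :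
    irrelevant ℬ ≤ (irrelevant 𝒜).map ψ := by
  rw [← toIdeal_le_toIdeal_iff]
  refine (toIdeal_irrelevant_le _).mpr fun i hi b hb => ?_
  obtain ⟨x, n, hx, e⟩ := isAwayMap_homogeneous ψ h hb
  have hu : IsUnit (ψ (algebraMap R A f) ^ n) := ((isAwayMap_iff.mp h).1).pow n
  change b ∈ ((irrelevant 𝒜).map ψ).toIdeal
  rw [← Ideal.mul_unit_mem_iff_mem _ hu, e]
  exact Ideal.mem_map_of_mem _ (mem_irrelevant_of_mem 𝒜 hi hx)

lemma awayMap_fromZero (s : A) (r : R) (r' : S) (hr : ψ (algebraMap R A r) = algebraMap S B r') :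
    HomogeneousLocalization.Away.map ψ s
      (HomogeneousLocalization.fromZeroRingHom 𝒜 (.powers s) (algebraMap R (𝒜 0) r)) =
    HomogeneousLocalization.fromZeroRingHom ℬ (.powers (ψ s)) (algebraMap S (ℬ 0) r') := by
  ext
  change Localization.mk (ψ (algebraMap R A r)) ⟨ψ 1, _⟩ =
    Localization.mk (algebraMap S B r') ⟨1, _⟩
  simp only [hr, map_one]

lemma isAwayMap_awayMap (h : IsAwayMap ψ.toRingHom (algebraMap R A f)) (f' : S)
    (hf : ψ (algebraMap R A f) = algebraMap S B f') {d : ℕ} {s : A}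
    (hs : s ∈ 𝒜 d) :
    IsAwayMap (HomogeneousLocalization.Away.map ψ s)
      (HomogeneousLocalization.fromZeroRingHom 𝒜 (.powers s) (algebraMap R (𝒜 0) f)) := by
  have h' := isAwayMap_iff.mp h
  have hu : IsUnit (algebraMap S B f') := hf ▸ h'.1
  have hval : (HomogeneousLocalization.fromZeroRingHom ℬ (.powers (ψ s))
      (algebraMap S (ℬ 0) f')).val = algebraMap B _ (algebraMap S B f') := rfl
  refine isAwayMap_iff.mpr ⟨?_, fun z => ?_, fun x hx => ?_⟩
  · rw [awayMap_fromZero ψ s f f' hf]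
    obtain ⟨v, hv⟩ := hu.exists_right_inv
    have hv0 : algebraMap S B f' * (DirectSum.decompose ℬ v 0 : B) = 1 := by
      have := DirectSum.coe_decompose_mul_of_left_mem_zero (𝒜 := ℬ) (b := v) (j := 0)
        (algebraMap_mem_zero ℬ f')
      rw [← this, hv, DirectSum.decompose_of_mem_same ℬ SetLike.GradedOne.one_mem]
    refine IsUnit.of_mul_eq_one (HomogeneousLocalization.fromZeroRingHom ℬ (.powers (ψ s))
      (DirectSum.decompose ℬ v 0)) ?_
    rw [← map_mul, ← map_one (HomogeneousLocalization.fromZeroRingHom ℬ (.powers (ψ s)))]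
    congr 1
    exact Subtype.ext hv0
  · rw [awayMap_fromZero ψ s f f' hf]
    obtain ⟨m, b, hb, rfl⟩ := HomogeneousLocalization.Away.mk_surjective ℬ (ψ.2 hs) z
    obtain ⟨x, n, hx, e⟩ := isAwayMap_homogeneous ψ h hb
    refine ⟨.mk 𝒜 hs m x hx, n, ?_⟩
    rw [HomogeneousLocalization.Away.map_mk]
    ext
    rw [HomogeneousLocalization.val_mul, HomogeneousLocalization.val_pow, hval,
      HomogeneousLocalization.Away.val_mk, HomogeneousLocalization.Away.val_mk,
      ← e, hf, ← map_pow (algebraMap B _), mul_comm, ← Algebra.smul_def,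
      Localization.smul_mk, smul_eq_mul, mul_comm b]
    rfl
  · obtain ⟨m, a, ha, rfl⟩ := HomogeneousLocalization.Away.mk_surjective 𝒜 hs x
    rw [HomogeneousLocalization.Away.map_mk] at hx
    have hx2 := congr(HomogeneousLocalization.val $hx)
    rw [HomogeneousLocalization.Away.val_mk, HomogeneousLocalization.val_zero, 
      Localization.mk_eq_mk', IsLocalization.mk'_eq_zero_iff] at hx2
    obtain ⟨⟨_, k, rfl⟩, hk⟩ := hx2
    have : ψ (s ^ k * a) = 0 := by rw [map_mul, map_pow]; exact hk
    obtain ⟨n, hn⟩ := h'.2.2 _ this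
    refine ⟨n, ?_⟩
    ext
    rw [HomogeneousLocalization.val_mul, HomogeneousLocalization.val_pow,
      HomogeneousLocalization.Away.val_mk, HomogeneousLocalization.val_zero,
      show (HomogeneousLocalization.fromZeroRingHom 𝒜 (.powers s)
      (algebraMap R (𝒜 0) f)).val = algebraMap A _ (algebraMap R A f) from rfl,
      ← map_pow, ← Algebra.smul_def, Localization.smul_mk, smul_eq_mul,
      Localization.mk_eq_mk', IsLocalization.mk'_eq_zero_iff]
    exact ⟨⟨_, k, rfl⟩, by rw [← hn]; simp; ring⟩
end Away

section Pushout
variable {R S A B : Type u} [CommRing R] [CommRing S] [CommRing A] [CommRing B]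
lemma isPushout_of_isAwayMap (φ : R →+* S) (α : R →+* A) (β : S →+* B) (ψ : A →+* B)
    (w : β.comp φ = ψ.comp α) (f : R) (hφ : IsAwayMap φ f) (hψ : IsAwayMap ψ (α f)) :
    IsPushout (CommRingCat.ofHom α) (CommRingCat.ofHom φ)
      (CommRingCat.ofHom ψ) (CommRingCat.ofHom β) := by
  let := φ.toAlgebra
  let := ψ.toAlgebra
  have : IsLocalization (Submonoid.powers f) S := ⟨hφ⟩
  have : IsLocalization ((Submonoid.powers f).map α) B := by
    rw [Submonoid.map_powers]; exact ⟨hψ⟩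
  exact CommRingCat.isPushout_of_isLocalization α β w (Submonoid.powers f)
end Pushout

section ProjSquare
open HomogeneousIdeal HomogeneousLocalization Limits
variable {R S A B : Type u} [CommRing R] [CommRing S] [CommRing A] [CommRing B]
  [Algebra R A] [Algebra S B] (𝒜 : ℕ → Submodule R A) {ℬ : ℕ → Submodule S B}
  [GradedAlgebra 𝒜] [GradedAlgebra ℬ]

/-- The structure morphism of the Proj of a graded `R`-algebra to `Spec R`. -/
def projToSpec : Proj 𝒜 ⟶ Spec (.of R) :=
  Proj.toSpecZero 𝒜 ≫ Spec.map (CommRingCat.ofHom (algebraMap R (𝒜 0)))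

variable {𝒜} (ψ : 𝒜 →+*ᵍ ℬ)

lemma awayι_projToSpec {d : ℕ} {s : A} (hs : s ∈ 𝒜 d) (hd : 0 < d) :
    Proj.awayι 𝒜 s hs hd ≫ projToSpec 𝒜 =
      Spec.map (CommRingCat.ofHom ((fromZeroRingHom 𝒜 (.powers s)).comp (algebraMap R (𝒜 0)))) := by
  rw [projToSpec, Proj.awayι_toSpecZero_assoc, ← Spec.map_comp]; rfl

lemma isPullback_awayι (h : irrelevant ℬ ≤ (irrelevant 𝒜).map ψ)
    {d : ℕ} {s : A} (hs : s ∈ 𝒜 d) (hd : 0 < d) :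
    IsPullback (Spec.map (CommRingCat.ofHom (Away.map ψ s))) (Proj.awayι ℬ (ψ s) (ψ.2 hs) hd)
      (Proj.awayι 𝒜 s hs hd) (Proj.map ψ h) :=
  IsOpenImmersion.isPullback _ _ _ _ (Proj.awayι_comp_map ψ h hd s hs) (by
    rw [Proj.opensRange_awayι, Proj.opensRange_awayι, Proj.map_preimage_basicOpen])

lemma isPullback_of_cover {W X Y Z : Scheme.{u}} {a : W ⟶ X} {b : W ⟶ Y} {c : X ⟶ Z} {e : Y ⟶ Z}
    (𝒰 : X.OpenCover) (V : 𝒰.I₀ → Scheme.{u}) (p : ∀ i, V i ⟶ 𝒰.X i) (q : ∀ i, V i ⟶ W)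
    (h₁ : ∀ i, IsPullback (p i) (q i) (𝒰.f i) a)
    (h₂ : ∀ i, IsPullback (p i) (q i ≫ b) (𝒰.f i ≫ c) e) : IsPullback a b c e := by
  refine Scheme.isPullback_of_openCover _ _ _ _ 𝒰 fun i => ?_
  let E := (h₁ i).flip.isoPullback
  refine IsPullback.of_iso (h₂ i) E (Iso.refl _) (Iso.refl _) (Iso.refl _) ?_ ?_ ?_ ?_
  · simp only [Iso.refl_hom, Category.comp_id]
    exact ((h₁ i).flip.isoPullback_hom_snd).symm
  · simp only [Iso.refl_hom, Category.comp_id]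
    rw [← Category.assoc]
    congr 1
    exact ((h₁ i).flip.isoPullback_hom_fst).symm
  · simp
  · simp

lemma isPullback_projMap (h : irrelevant ℬ ≤ (irrelevant 𝒜).map ψ) (φ : R →+* S)
    (hφψ : ∀ r, ψ (algebraMap R A r) = algebraMap S B (φ r)) (f : R)
    (hφ : IsAwayMap φ f) (hψ : IsAwayMap ψ.toRingHom (algebraMap R A f)) :
    IsPullback (Proj.map ψ h) (projToSpec ℬ) (projToSpec 𝒜) (Spec.map (CommRingCat.ofHom φ)) := by
  refine isPullback_of_cover (Proj.affineOpenCover 𝒜).openCover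
    (fun s => Spec (.of (Away ℬ (ψ s.2))))
    (fun s => Spec.map (CommRingCat.ofHom (Away.map ψ (s.2 : A))))
    (fun s => Proj.awayι ℬ (ψ s.2) (ψ.2 s.2.2) s.1.2)
    (fun s => isPullback_awayι ψ h s.2.2 s.1.2) fun s => ?_
  have e1 : (Proj.affineOpenCover 𝒜).openCover.f s ≫ projToSpec 𝒜 =
      Spec.map (CommRingCat.ofHom ((fromZeroRingHom 𝒜 (.powers (s.2 : A))).comp
        (algebraMap R (𝒜 0)))) := awayι_projToSpec s.2.2 s.1.2
  have e2 : Proj.awayι ℬ (ψ s.2) (ψ.2 s.2.2) s.1.2 ≫ projToSpec ℬ =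
      Spec.map (CommRingCat.ofHom ((fromZeroRingHom ℬ (.powers (ψ (s.2 : A)))).comp
        (algebraMap S (ℬ 0)))) := awayι_projToSpec (ψ.2 s.2.2) s.1.2
  suffices h : IsPullback (Spec.map (CommRingCat.ofHom (Away.map ψ (s.2 : A))))
      (Spec.map (CommRingCat.ofHom ((fromZeroRingHom ℬ (.powers (ψ (s.2 : A)))).comp
        (algebraMap S (ℬ 0)))))
      (Spec.map (CommRingCat.ofHom ((fromZeroRingHom 𝒜 (.powers (s.2 : A))).comp
        (algebraMap R (𝒜 0)))))
      (Spec.map (CommRingCat.ofHom φ)) from e1 ▸ e2 ▸ h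
  refine isPullback_SpecMap_of_isPushout _ _ _ _ ?_
  refine isPushout_of_isAwayMap _ _ _ _ ?_ f hφ ?_
  · ext1 r
    exact (awayMap_fromZero ψ (s.2 : A) r (φ r) (hφψ r)).symm
  · exact isAwayMap_awayMap ψ hψ (φ f) (hφψ f) s.2.2
end ProjSquare

end Algebra

open Scheme.AffineZariskiSite (toOpens toOpens_mono basicOpen_le directedCover restrictIsoSpec)

section RelProj

/-- The restriction maps of the structure sheaf between affine opens. -/
def resO {X : Scheme.{u}} {U V : X.AffineZariskiSite} (h : U ≤ V) : Γ(X, V.1) →+* Γ(X, U.1) :=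
  (X.presheaf.map (homOfLE (toOpens_mono h)).op).hom

/-- A presheaf of `ℕ`-graded `𝒪_X`-algebras on the affine opens of `X`
(and the inclusions of basic opens). -/
structure GradedAlg (X : Scheme.{u}) where
  /-- The sections over an affine open. -/
  obj : X.AffineZariskiSite → Type u
  [commRing : ∀ U, CommRing (obj U)]
  [algebra : ∀ U, Algebra Γ(X, U.1) (obj U)]
  /-- The grading. -/
  gr : ∀ U, ℕ → Submodule Γ(X, U.1) (obj U)
  [gradedAlgebra : ∀ U, GradedAlgebra (gr U)]
  /-- The restriction maps. -/
  res : ∀ {U V : X.AffineZariskiSite} (_ : U ≤ V), gr V →+*ᵍ gr U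
  res_algebraMap : ∀ {U V : X.AffineZariskiSite} (h : U ≤ V) (r : Γ(X, V.1)),
    res h (algebraMap _ (obj V) r) = algebraMap _ (obj U) (resO h r)
  res_self : ∀ U, res (le_refl U) = .id (gr U)
  res_res : ∀ {U V W : X.AffineZariskiSite} (h : U ≤ V) (h' : V ≤ W),
    (res h).comp (res h') = res (h.trans h')

namespace GradedAlg
variable {X : Scheme.{u}} (𝒜 : GradedAlg X)

instance (U : X.AffineZariskiSite) : CommRing (𝒜.obj U) := 𝒜.commRing U
instance (U : X.AffineZariskiSite) : Algebra Γ(X, U.1) (𝒜.obj U) := 𝒜.algebra U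
instance (U : X.AffineZariskiSite) : GradedAlgebra (𝒜.gr U) := 𝒜.gradedAlgebra U

/-- Quasi-coherence: the sections over the basic open of `f` in an affine open `U` are the
localization at `f` of the sections over `U`. -/
class IsQuasiCoherent : Prop where
  isAwayMap : ∀ (U : X.AffineZariskiSite) (f : Γ(X, U.1)),
    IsAwayMap (𝒜.res (U.basicOpen_le f)).toRingHom (algebraMap _ (𝒜.obj U) f)

variable [𝒜.IsQuasiCoherent]

lemma isAwayMap_resO (U : X.AffineZariskiSite) (f : Γ(X, U.1)) :
    IsAwayMap (resO (U.basicOpen_le f)) f :=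
  (U.2.isLocalization_basicOpen f).1

open HomogeneousIdeal in
lemma irrelevant_le {U V : X.AffineZariskiSite} (h : U ≤ V) :
    irrelevant (𝒜.gr U) ≤ (irrelevant (𝒜.gr V)).map (𝒜.res h) := by
  obtain ⟨f, hf⟩ := id h
  obtain rfl : V.basicOpen f = U := Subtype.ext hf
  exact irrelevant_le_of_isAwayMap _ (IsQuasiCoherent.isAwayMap V f)

/-- The functor taking an affine open `U` to `Proj 𝒜(U)`. -/
def projFunctor : X.AffineZariskiSite ⥤ Scheme.{u} where
  obj U := Proj (𝒜.gr U)
  map h := Proj.map (𝒜.res h.le) (𝒜.irrelevant_le h.le)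
  map_id U := by
    simp only [𝒜.res_self]
    exact Proj.map_id
  map_comp {U V W} h h' := by
    rw [← Proj.map_comp]
    simp only [𝒜.res_res]

/-- `Proj 𝒜(U) ⟶ Spec 𝒪_X(U)`, as a natural transformation. -/
def projToSpecNat : 𝒜.projFunctor ⟶
    Scheme.AffineZariskiSite.toOpensFunctor X ⋙ X.presheaf.rightOp ⋙ Scheme.Spec where
  app U := projToSpec (𝒜.gr U)
  naturality U V h := by
    obtain ⟨f, hf⟩ := id h.le
    obtain rfl : V.basicOpen f = U := Subtype.ext hf
    exact (isPullback_projMap (𝒜.res h.le) (𝒜.irrelevant_le h.le) (resO h.le)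
      (𝒜.res_algebraMap h.le) f (isAwayMap_resO V f) (IsQuasiCoherent.isAwayMap V f)).w

lemma projToSpecNat_equifibered : 𝒜.projToSpecNat.Equifibered := by
  intro U V h
  obtain ⟨f, hf⟩ := id h.le
  obtain rfl : V.basicOpen f = U := Subtype.ext hf
  exact isPullback_projMap (𝒜.res h.le) (𝒜.irrelevant_le h.le) (resO h.le)
      (𝒜.res_algebraMap h.le) f (isAwayMap_resO V f) (IsQuasiCoherent.isAwayMap V f)

/-- `Proj 𝒜(U) ⟶ U`, as a natural transformation. -/
def projToOpens : 𝒜.projFunctor ⟶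
    Scheme.AffineZariskiSite.toOpensFunctor X ⋙ X.restrictFunctor ⋙ Over.forget _ :=
  𝒜.projToSpecNat ≫ (restrictIsoSpec X).inv

lemma projToOpens_equifibered : 𝒜.projToOpens.Equifibered :=
  𝒜.projToSpecNat_equifibered.comp (.of_isIso _)

/-- The gluing datum of the schemes `Proj 𝒜(U)` over the affine opens `U` of `X`. -/
def projGluingData : (directedCover X).RelativeGluingData where
  functor := 𝒜.projFunctor
  natTrans := 𝒜.projToOpens
  equifibered := 𝒜.projToOpens_equifibered

/-- The relative Proj of a quasi-coherent graded `𝒪_X`-algebra. -/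
def relProj : Scheme.{u} := 𝒜.projGluingData.glued

/-- The structure morphism of the relative Proj. -/
def proj : 𝒜.relProj ⟶ X := 𝒜.projGluingData.toBase

/-- The open immersion of `Proj 𝒜(U)` into the relative Proj. -/
def chart (U : X.AffineZariskiSite) : Proj (𝒜.gr U) ⟶ 𝒜.relProj :=
  𝒜.projGluingData.cover.f U

lemma chart_proj (U : X.AffineZariskiSite) :
    𝒜.chart U ≫ 𝒜.proj = projToSpec (𝒜.gr U) ≫ U.2.fromSpec := by
  refine (𝒜.projGluingData.ι_toBase U).trans ?_
  change (projToSpec (𝒜.gr U) ≫ U.2.isoSpec.inv) ≫ U.1.ι = _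
  rw [Category.assoc, IsAffineOpen.isoSpec_inv_ι]

instance (U : X.AffineZariskiSite) : IsOpenImmersion (𝒜.chart U) :=
  𝒜.projGluingData.cover.map_prop U

lemma isPullback_chart (U : X.AffineZariskiSite) :
    IsPullback (projToSpec (𝒜.gr U)) (𝒜.chart U) U.2.fromSpec 𝒜.proj := by
  have h := 𝒜.projGluingData.isPullback_natTrans_ι_toBase U
  refine IsPullback.of_iso h (Iso.refl _) U.2.isoSpec (Iso.refl _) (Iso.refl _) ?_ ?_ ?_ ?_
  · change (projToSpec (𝒜.gr U) ≫ U.2.isoSpec.inv) ≫ U.2.isoSpec.hom = 𝟙 _ ≫ projToSpec (𝒜.gr U)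
    rw [Category.assoc, Iso.inv_hom_id, Category.id_comp, Category.comp_id]
  · exact (Category.comp_id _).trans (Category.id_comp _).symm
  · refine (Category.comp_id _).trans ?_
    change U.1.ι = U.2.isoSpec.hom ≫ U.2.isoSpec.inv ≫ U.1.ι
    rw [Iso.hom_inv_id_assoc]
  · exact (Category.comp_id _).trans (Category.id_comp _).symm
end GradedAlg
end RelProj

section Blowup
variable {X : Scheme.{u}} (J : X.IdealSheafData)

lemma ideal_le_comap {U V : X.AffineZariskiSite} (h : U ≤ V) :
    J.ideal ⟨V.1, V.2⟩ ≤ (J.ideal ⟨U.1, U.2⟩).comap (resO h) :=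
  J.ideal_le_comap_ideal (U := ⟨U.1, U.2⟩) (V := ⟨V.1, V.2⟩) (toOpens_mono h)

/-- The sections of an ideal sheaf over an affine open. -/
abbrev idealOf (U : X.AffineZariskiSite) : Ideal Γ(X, U.1) := J.ideal ⟨U.1, U.2⟩

lemma resO_self (U : X.AffineZariskiSite) (r : Γ(X, U.1)) : resO (le_refl U) r = r := by
  simp [resO]

lemma resO_resO {U V W : X.AffineZariskiSite} (h : U ≤ V) (h' : V ≤ W) (r : Γ(X, W.1)) :
    resO h (resO h' r) = resO (h.trans h') r := by
  simp only [resO, ← RingHom.comp_apply, ← CommRingCat.hom_comp, ← Functor.map_comp]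
  rfl

lemma symGraded_hom_ext {R A : Type*} [CommRing R] [CommRing A] {N : Type*} [AddCommGroup N]
    [Module R N] {σ : Type*} [SetLike σ A] {𝒮 : ℕ → σ}
    {f g : symGrading R N →+*ᵍ 𝒮} (h₀ : ∀ r, f (algebraMap R _ r) = g (algebraMap R _ r))
    (h₁ : ∀ x, f (SymmetricAlgebra.ι R N x) = g (SymmetricAlgebra.ι R N x)) : f = g := by
  have := symmetricAlgebra_ringHom_ext (f := f.toRingHom) (g := g.toRingHom) h₀ h₁
  ext x
  exact congr($this x)

/-- The symmetric algebra of an ideal sheaf. -/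
def symAlg : GradedAlg X where
  obj U := SymmetricAlgebra Γ(X, U.1) (idealOf J U)
  gr U := symGrading Γ(X, U.1) (idealOf J U)
  res h := symMap (resO h) (ideal_le_comap J h)
  res_algebraMap h r := symMap_algebraMap _ _ r
  res_self U := by
    refine symGraded_hom_ext (fun r => ?_) fun x => ?_
    · rw [symMap_algebraMap, resO_self]; rfl
    · rw [symMap_ι]
      change _ = SymmetricAlgebra.ι _ _ x
      congr 1
      ext1
      exact resO_self U _
  res_res h h' := by
    refine symGraded_hom_ext (fun r => ?_) fun x => ?_
    · rw [GradedRingHom.comp_apply, symMap_algebraMap, symMap_algebraMap, symMap_algebraMap,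
        resO_resO]
    · rw [GradedRingHom.comp_apply, symMap_ι, symMap_ι, symMap_ι]
      congr 1
      ext1
      exact resO_resO h h' _

/-- The Rees algebra of an ideal sheaf. -/
def reesAlg : GradedAlg X where
  obj U := reesAlgebra (idealOf J U)
  gr U := reesGrading (idealOf J U)
  res h := reesMap (resO h) (ideal_le_comap J h)
  res_algebraMap h r := by
    ext1; simp
  res_self U := by
    ext x n
    rw [coe_reesMap, Polynomial.coeff_map, resO_self]
    rfl
  res_res h h' := by
    ext x n
    rw [GradedRingHom.comp_apply, coe_reesMap, coe_reesMap, coe_reesMap, Polynomial.coeff_map,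
      Polynomial.coeff_map, Polynomial.coeff_map, resO_resO]

lemma map_idealOf (U : X.AffineZariskiSite) (f : Γ(X, U.1)) :
    (idealOf J U).map (resO (U.basicOpen_le f)) = idealOf J (U.basicOpen f) :=
  J.map_ideal_basicOpen ⟨U.1, U.2⟩ f

lemma isAwayMap_symAlg (U : X.AffineZariskiSite) (f : Γ(X, U.1)) :
    IsAwayMap (symMap _ (ideal_le_comap J (U.basicOpen_le f))).toRingHom (algebraMap _ _ f) :=
  isAwayMap_symMap (ideal_le_comap J (U.basicOpen_le f)) (GradedAlg.isAwayMap_resO U f)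
    (map_idealOf J U f)

lemma isAwayMap_reesAlg (U : X.AffineZariskiSite) (f : Γ(X, U.1)) :
    IsAwayMap (reesMap _ (ideal_le_comap J (U.basicOpen_le f))).toRingHom (algebraMap _ _ f) :=
  isAwayMap_reesMap (ideal_le_comap J (U.basicOpen_le f)) (GradedAlg.isAwayMap_resO U f)
    (map_idealOf J U f)

instance : (symAlg J).IsQuasiCoherent where
  isAwayMap U f := isAwayMap_symAlg J U f

instance : (reesAlg J).IsQuasiCoherent where
  isAwayMap U f := isAwayMap_reesAlg J U f

end Blowup

section ExternalSum
variable {R B R' B' : Type*} [CommRing R] [CommRing B] [Algebra R B]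
  [CommRing R'] [CommRing B'] [Algebra R' B']
  (L : ℕ → Submodule R B)

/-- The grading of the external direct sum of the terms of a graded family of submodules. -/
def sumGrading (d : ℕ) : Submodule R (⨁ d, L d) :=
  LinearMap.range (DirectSum.lof R ℕ (fun d => L d) d)

lemma of_mem_sumGrading {d : ℕ} (x : L d) :
    DirectSum.of (fun d => L d) d x ∈ sumGrading L d := ⟨x, rfl⟩

variable [SetLike.GradedMonoid L]

instance sumGrading.gradedMonoid : SetLike.GradedMonoid (sumGrading L) where
  one_mem := ⟨⟨1, SetLike.GradedOne.one_mem⟩, rfl⟩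
  mul_mem := by
    rintro i j _ _ ⟨x, rfl⟩ ⟨y, rfl⟩
    rw [DirectSum.lof_eq_of, DirectSum.lof_eq_of, DirectSum.of_mul_of]
    exact of_mem_sumGrading L _

/-- The inclusion of a term, with values in the graded part. -/
def ofSumGrading (d : ℕ) : L d →+ sumGrading L d :=
  (DirectSum.of (fun d => L d) d).codRestrict (sumGrading L d) (of_mem_sumGrading L)

/-- The decomposition of the external sum into its graded parts. -/
def sumDecompose : (⨁ d, L d) →+ ⨁ d, sumGrading L d :=
  DirectSum.map (ofSumGrading L)

lemma sumDecompose_of (d : ℕ) (x : L d) : sumDecompose L (DirectSum.of (fun d => L d) d x) =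
    DirectSum.of (fun d => sumGrading L d) d ⟨_, of_mem_sumGrading L x⟩ :=
  DirectSum.map_of _ _ _

instance sumGrading.gradedAlgebra : GradedAlgebra (sumGrading L) where
  decompose' := sumDecompose L
  left_inv x := by
    induction x using DirectSum.induction_on with
    | zero => rw [map_zero, map_zero]
    | of i x => rw [sumDecompose_of, DirectSum.coeAddMonoidHom_of]
    | add x y hx hy => rw [map_add, map_add, hx, hy]
  right_inv x := by
    induction x using DirectSum.induction_on with
    | zero => rw [map_zero, map_zero]
    | of i x =>
      obtain ⟨_, x, rfl⟩ := x
      rw [DirectSum.coeAddMonoidHom_of]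
      exact sumDecompose_of _ _ _
    | add x y hx hy => rw [map_add, map_add, hx, hy]

variable (L' : ℕ → Submodule R' B') [SetLike.GradedMonoid L']

variable {L L'} in
/-- The ring map between external direct sums induced by a ring map respecting the terms. -/
def sumMap (θ : B →+* B') (hθ : ∀ d x, x ∈ L d → θ x ∈ L' d) :
    (⨁ d, L d) →+* ⨁ d, L' d :=
  DirectSum.toSemiring
    (fun d => (DirectSum.of (fun d => L' d) d).comp
      (((θ : B →+ B').comp (L d).toAddSubgroup.subtype).codRestrict (L' d) fun x => hθ d x x.2))
    (congrArg (DirectSum.of (fun d => L' d) 0) (Subtype.ext (map_one θ)))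
    (fun {i j} x y => by
      refine Eq.trans ?_ (DirectSum.of_mul_of _ _).symm
      exact congrArg (DirectSum.of (fun d => L' d) (i + j)) (Subtype.ext (map_mul θ _ _)))

variable {L L'} in
@[simp] lemma sumMap_of (θ : B →+* B') (hθ : ∀ d x, x ∈ L d → θ x ∈ L' d) (d : ℕ) (x : L d) :
    sumMap θ hθ (DirectSum.of (fun d => L d) d x) =
      DirectSum.of (fun d => L' d) d ⟨θ x, hθ d x x.2⟩ :=
  DirectSum.toSemiring_of _ _ _ _ _

variable {L L'} in
/-- `sumMap` as a map of graded rings. -/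
def sumGradedMap (θ : B →+* B') (hθ : ∀ d x, x ∈ L d → θ x ∈ L' d) :
    sumGrading L →+*ᵍ sumGrading L' where
  toRingHom := sumMap θ hθ
  map_mem := by
    rintro d _ ⟨x, rfl⟩
    change sumMap θ hθ (DirectSum.of _ d x) ∈ _
    rw [sumMap_of]
    exact of_mem_sumGrading L' _

end ExternalSum

/-- A graded ring is the external direct sum of its graded parts; hence a ring map carrying its
graded parts into a graded family of submodules induces a map to their external direct sum. -/
def toSum {R B R' B' : Type*} [CommRing R] [CommRing B] [Algebra R B] [CommRing R'] [CommRing B']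
    [Algebra R' B'] {L : ℕ → Submodule R B} [GradedAlgebra L]
    (L' : ℕ → Submodule R' B') [SetLike.GradedMonoid L'] (θ : B →+* B') (hθ : ∀ d x, x ∈ L d → θ x ∈ L' d) :
    L →+*ᵍ sumGrading L' where
  toRingHom := (sumMap θ hθ).comp (DirectSum.decomposeRingEquiv L).toRingHom
  map_mem {d x} hx := by
    change sumMap θ hθ (DirectSum.decompose L x) ∈ _
    rw [DirectSum.decompose_of_mem L hx, sumMap_of]
    exact of_mem_sumGrading L' _
lemma toSum_of_mem {R B R' B' : Type*} [CommRing R] [CommRing B] [Algebra R B] [CommRing R']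
    [CommRing B'] [Algebra R' B'] {L : ℕ → Submodule R B} [GradedAlgebra L]
    (L' : ℕ → Submodule R' B') [SetLike.GradedMonoid L']
    (θ : B →+* B') (hθ : ∀ d x, x ∈ L d → θ x ∈ L' d) {d : ℕ} {x : B} (hx : x ∈ L d) :
    toSum L' θ hθ x = DirectSum.of (fun d => L' d) d ⟨θ x, hθ d x hx⟩ := by
  change sumMap θ hθ (DirectSum.decompose L x) = _
  rw [DirectSum.decompose_of_mem L hx, sumMap_of]

namespace GradedAlg
variable {X : Scheme.{u}} (𝒮 : GradedAlg X)

/-- A presheaf of ideals of a graded algebra. -/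
structure IdealFamily where
  /-- The sections over an affine open. -/
  ideal : ∀ U, Ideal (𝒮.obj U)
  le_comap : ∀ {U V : X.AffineZariskiSite} (h : U ≤ V),
    ideal V ≤ (ideal U).comap (𝒮.res h).toRingHom

variable {𝒮} (𝒦 : Set 𝒮.IdealFamily)

/-- The degree `d` part of the inverse limit of the quotients `𝒮 / K`, for `K` in a set `𝒦` of
ideals ordered by inclusion, with the quotient maps as transition maps. -/
def limPart (U : X.AffineZariskiSite) (d : ℕ) :
    Submodule Γ(X, U.1) (∀ K : 𝒦, 𝒮.obj U ⧸ K.1.ideal U) where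
  carrier := {x | (∀ K, ∃ a ∈ 𝒮.gr U d, Ideal.Quotient.mk _ a = x K) ∧
    ∀ (K K' : 𝒦) (h : ∀ W, K.1.ideal W ≤ K'.1.ideal W), Ideal.Quotient.factor (h U) (x K) = x K'}
  add_mem' := by
    rintro x y ⟨hx, hx'⟩ ⟨hy, hy'⟩
    refine ⟨fun K => ?_, fun K K' h => ?_⟩
    · obtain ⟨a, ha, ha'⟩ := hx K
      obtain ⟨b, hb, hb'⟩ := hy K
      exact ⟨a + b, add_mem ha hb, by rw [map_add, ha', hb']; rfl⟩
    · rw [Pi.add_apply, map_add, hx' K K' h, hy' K K' h]; rfl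
  zero_mem' := ⟨fun K => ⟨0, zero_mem _, map_zero _⟩, fun K K' h => map_zero _⟩
  smul_mem' := by
    rintro r x ⟨hx, hx'⟩
    refine ⟨fun K => ?_, fun K K' h => ?_⟩
    · obtain ⟨a, ha, ha'⟩ := hx K
      refine ⟨r • a, Submodule.smul_mem _ r ha, ?_⟩
      rw [Pi.smul_apply, ← ha']; rfl
    · obtain ⟨a, ha, ha'⟩ := hx K
      rw [Pi.smul_apply, Pi.smul_apply, ← hx' K K' h, ← ha']
      rfl

instance limPart.gradedMonoid (U : X.AffineZariskiSite) :
    SetLike.GradedMonoid (limPart 𝒦 U) where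
  one_mem := ⟨fun K => ⟨1, SetLike.GradedOne.one_mem, map_one _⟩, fun K K' h => map_one _⟩
  mul_mem := by
    rintro i j x y ⟨hx, hx'⟩ ⟨hy, hy'⟩
    refine ⟨fun K => ?_, fun K K' h => ?_⟩
    · obtain ⟨a, ha, ha'⟩ := hx K
      obtain ⟨b, hb, hb'⟩ := hy K
      exact ⟨a * b, SetLike.mul_mem_graded ha hb, by rw [map_mul, ha', hb']; rfl⟩
    · rw [Pi.mul_apply, map_mul, hx' K K' h, hy' K K' h]; rfl

/-- The restriction maps of the product of the quotients. -/
def prodRes {U V : X.AffineZariskiSite} (h : U ≤ V) :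
    (∀ K : 𝒦, 𝒮.obj V ⧸ K.1.ideal V) →+* ∀ K : 𝒦, 𝒮.obj U ⧸ K.1.ideal U :=
  RingHom.pi fun K =>
    (Ideal.quotientMap (K.1.ideal U) (𝒮.res h).toRingHom (K.1.le_comap h)).comp
      (Pi.evalRingHom _ K)

lemma prodRes_apply {U V : X.AffineZariskiSite} (h : U ≤ V)
    (x : ∀ K : 𝒦, 𝒮.obj V ⧸ K.1.ideal V) (K : 𝒦) : prodRes 𝒦 h x K =
      Ideal.quotientMap (K.1.ideal U) (𝒮.res h).toRingHom (K.1.le_comap h) (x K) := rfl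

lemma prodRes_self (U : X.AffineZariskiSite) (x : ∀ K : 𝒦, 𝒮.obj U ⧸ K.1.ideal U) :
    prodRes 𝒦 (le_refl U) x = x := by
  funext K
  rw [prodRes_apply]
  obtain ⟨a, ha⟩ := Ideal.Quotient.mk_surjective (x K)
  rw [← ha, Ideal.quotientMap_mk]
  exact congrArg _ (congr($(𝒮.res_self U) a))

lemma prodRes_prodRes {U V W : X.AffineZariskiSite} (h : U ≤ V) (h' : V ≤ W)
    (x : ∀ K : 𝒦, 𝒮.obj W ⧸ K.1.ideal W) :
    prodRes 𝒦 h (prodRes 𝒦 h' x) = prodRes 𝒦 (h.trans h') x := by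
  funext K
  rw [prodRes_apply, prodRes_apply, prodRes_apply]
  obtain ⟨a, ha⟩ := Ideal.Quotient.mk_surjective (x K)
  rw [← ha, Ideal.quotientMap_mk, Ideal.quotientMap_mk, Ideal.quotientMap_mk]
  exact congrArg _ (congr($(𝒮.res_res h h') a))

lemma prodRes_mem {U V : X.AffineZariskiSite} (h : U ≤ V) (d : ℕ)
    (x : ∀ K : 𝒦, 𝒮.obj V ⧸ K.1.ideal V) (hx : x ∈ limPart 𝒦 V d) :
    prodRes 𝒦 h x ∈ limPart 𝒦 U d := by
  refine ⟨fun K => ?_, fun K K' hK => ?_⟩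
  · obtain ⟨a, ha, ha'⟩ := hx.1 K
    exact ⟨𝒮.res h a, (𝒮.res h).2 ha, by rw [prodRes_apply, ← ha']; rfl⟩
  · obtain ⟨a, ha, ha'⟩ := hx.1 K
    rw [prodRes_apply, prodRes_apply, ← hx.2 K K' hK, ← ha']
    rfl

/-- The inverse limit, in the category of graded algebras, of the quotients `𝒮 / K` of a graded
algebra `𝒮`, for `K` in a set `𝒦` of ideals ordered by inclusion, with the quotient maps as
transition maps: its degree `d` part is the inverse limit of the degree `d` parts. -/
def limQuot : GradedAlg X where
  obj U := ⨁ d, limPart 𝒦 U d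
  gr U := sumGrading (limPart 𝒦 U)
  res h := sumGradedMap (prodRes 𝒦 h) (prodRes_mem 𝒦 h)
  res_algebraMap {U V} h r := by
    rw [DirectSum.algebraMap_apply, DirectSum.algebraMap_apply]
    refine (sumMap_of _ (prodRes_mem 𝒦 h) 0 _).trans ?_
    refine congrArg (DirectSum.of (fun d => limPart 𝒦 U d) 0) (Subtype.ext ?_)
    funext K
    exact congrArg (Ideal.Quotient.mk (K.1.ideal U)) (𝒮.res_algebraMap h r)
  res_self U := by
    refine GradedRingHom.ext fun x => ?_
    change sumMap _ (prodRes_mem 𝒦 (le_refl U)) x = x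
    induction x using DirectSum.induction_on with
    | zero => rw [map_zero]
    | of i x =>
      rw [sumMap_of]
      exact congrArg _ (Subtype.ext (prodRes_self 𝒦 U x))
    | add x y hx hy => rw [map_add, hx, hy]
  res_res {U V W} h h' := by
    refine GradedRingHom.ext fun x => ?_
    change sumMap _ (prodRes_mem 𝒦 h) (sumMap _ (prodRes_mem 𝒦 h') x) =
      sumMap _ (prodRes_mem 𝒦 (h.trans h')) x
    induction x using DirectSum.induction_on with
    | zero => rw [map_zero, map_zero, map_zero]
    | of i x =>
      rw [sumMap_of, sumMap_of, sumMap_of]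
      exact congrArg _ (Subtype.ext (prodRes_prodRes 𝒦 h h' x))
    | add x y hx hy => rw [map_add, map_add, map_add, hx, hy]

/-- The canonical map from a graded algebra to the inverse limit of its quotients. -/
def toLimQuot (U : X.AffineZariskiSite) : 𝒮.gr U →+*ᵍ (limQuot 𝒦).gr U :=
  toSum (limPart 𝒦 U) (RingHom.pi fun K : 𝒦 => Ideal.Quotient.mk (K.1.ideal U))
    fun _ a ha => ⟨fun _ => ⟨a, ha, rfl⟩, fun _ _ _ => rfl⟩

end GradedAlg

section QSymAffine
open TensorProduct
variable {R A : Type*} [CommRing R] [CommRing A] (φ : R →+* A) {I : Ideal R} {𝔞 : Ideal A}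
  (h : I ≤ 𝔞.comap φ)

/-- The kernel of the canonical surjection from `Sym_A(𝔞)` to the quasi-symmetric algebra
`Sym_A(𝔞) ⊗_{Sym_R(I)} Rees_R(I)` of a ring map `R → A` carrying `I` into `𝔞`. -/
def qSymKernel : Ideal (SymmetricAlgebra A 𝔞) :=
  letI := (symMap φ h).toRingHom.toAlgebra
  letI := (symToRees I).toRingHom.toAlgebra
  RingHom.ker (Algebra.TensorProduct.includeLeftRingHom :
    SymmetricAlgebra A 𝔞 →+* SymmetricAlgebra A 𝔞 ⊗[SymmetricAlgebra R I] reesAlgebra I)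

end QSymAffine

section QSymSheaf
variable {X Y M : Scheme.{u}} (y : Y ⟶ X) [QuasiCompact y] (i : X ⟶ M) [IsAffineHom i]

/-- The preimage of an affine open. -/
def preim (V : M.AffineZariskiSite) : X.AffineZariskiSite := ⟨i ⁻¹ᵁ V.1, V.2.preimage i⟩

/-- The map `𝒪_M(V) → 𝒪_X(i⁻¹ V)`. -/
def sectionMap (V : M.AffineZariskiSite) : Γ(M, V.1) →+* Γ(X, (preim i V).1) := (i.app V.1).hom

lemma ideal_le_comap_sectionMap (V : M.AffineZariskiSite) :
    idealOf (y ≫ i).ker V ≤ (idealOf y.ker (preim i V)).comap (sectionMap i V) := by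
  intro r hr
  simp only [idealOf, Scheme.Hom.ker_apply, RingHom.mem_ker, Ideal.mem_comap] at hr ⊢
  rw [Scheme.Hom.comp_app] at hr
  exact hr

/-- The map `Sym_{𝒪_M}(J_{Y,M})(V) → Sym_{𝒪_X}(J_{Y,X})(i⁻¹ V)`. -/
def symPull (V : M.AffineZariskiSite) :
    (symAlg (y ≫ i).ker).gr V →+*ᵍ (symAlg y.ker).gr (preim i V) :=
  symMap (sectionMap i V) (ideal_le_comap_sectionMap y i V)

/-- The kernel of the surjection from `Sym_{𝒪_X}(J_{Y,X})` to the quasi-symmetric algebra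
`Sym_{𝒪_X}(J_{Y,X}) ⊗_{Sym_{𝒪_M}(J_{Y,M})} Rees_{𝒪_M}(J_{Y,M})`: a section belongs to it if it does
so locally, on small enough basic opens of the preimages in `X` of the affine opens of `M`. -/
def qSymKer : (symAlg y.ker).IdealFamily where
  ideal U :=
    { carrier := {a | ∀ (V : M.AffineZariskiSite) (W : X.AffineZariskiSite) (hU : W ≤ U)
        (hV : W ≤ preim i V), (symAlg y.ker).res hU a ∈
          (qSymKernel (sectionMap i V) (ideal_le_comap_sectionMap y i V)).map
            ((symAlg y.ker).res hV).toRingHom}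
      add_mem' := fun ha hb V W hU hV => by
        rw [map_add]; exact add_mem (ha V W hU hV) (hb V W hU hV)
      zero_mem' := fun V W hU hV => by
        rw [map_zero]; exact zero_mem _
      smul_mem' := fun c a ha V W hU hV => by
        rw [smul_eq_mul, map_mul]; exact Ideal.mul_mem_left _ _ (ha V W hU hV) }
  le_comap {U U'} h a ha V W hU hV := by
    have := ha V W (hU.trans h) hV
    rw [← (symAlg y.ker).res_res hU h] at this
    exact this

end QSymSheaf

section QuasiSymmetricAlgebra
variable {k : Type u} [Field k] {X Y : Scheme.{u}} (s : X ⟶ Spec (.of k)) (y : Y ⟶ X)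
  [QuasiCompact y]

/-- The ideals `K` of `Sym_{𝒪_X}(J_{Y,X})` such that `Sym_{𝒪_X}(J_{Y,X}) / K` is the
quasi-symmetric algebra of a closed embedding of `X` in a scheme `M` of finite type over `k`. -/
def embeddingKernels : Set (symAlg y.ker).IdealFamily :=
  {K | ∃ (M : Scheme.{u}) (t : M ⟶ Spec (.of k)) (i : X ⟶ M) (_ : LocallyOfFiniteType t)
    (_ : QuasiCompact t) (_ : IsClosedImmersion i), i ≫ t = s ∧ K = qSymKer y i}

/-- The quasi-symmetric algebra of `J_{Y,X}`: the inverse limit of the quasi-symmetric algebras of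
the closed embeddings of `X` in schemes `M` of finite type over `k`. These are quotients of
`Sym_{𝒪_X}(J_{Y,X})`, and the transition maps are the maps of quotients of `Sym_{𝒪_X}(J_{Y,X})`.
Isomorphic quotients count once, so that the index set is small; as any two closed
embeddings of `X` are dominated by a third one (the pushout `M ∪_X N` contains both `M` and `N`),
this is the limit over all closed embeddings. -/
def qSymAlg : GradedAlg X := GradedAlg.limQuot (embeddingKernels s y)

/-- The canonical map from the symmetric algebra to the quasi-symmetric algebra. -/
def symToQSym (U : X.AffineZariskiSite) : (symAlg y.ker).gr U →+*ᵍ (qSymAlg s y).gr U :=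
  GradedAlg.toLimQuot (embeddingKernels s y) U

end QuasiSymmetricAlgebra

namespace GradedAlg

lemma irrelevant_le_of_surjective {R S A B : Type*} [CommRing R] [CommRing S] [CommRing A]
    [CommRing B] [Algebra R A] [Algebra S B] {𝒜 : ℕ → Submodule R A} {ℬ : ℕ → Submodule S B}
    [GradedAlgebra 𝒜] [GradedAlgebra ℬ] (ψ : 𝒜 →+*ᵍ ℬ) (h : Function.Surjective ψ) :
    HomogeneousIdeal.irrelevant ℬ ≤ (HomogeneousIdeal.irrelevant 𝒜).map ψ := by
  change (HomogeneousIdeal.irrelevant ℬ).toIdeal ≤ ((HomogeneousIdeal.irrelevant 𝒜).map ψ).toIdeal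
  refine (HomogeneousIdeal.toIdeal_irrelevant_le _).mpr fun i hi b hb => ?_
  obtain ⟨x, rfl⟩ := h b
  have : ψ (DirectSum.decompose 𝒜 x i) = ψ x := by
    rw [GradedRingHom.map_directSumDecompose, DirectSum.decompose_of_mem_same ℬ hb]
  rw [← this]
  exact Ideal.mem_map_of_mem _ (HomogeneousIdeal.mem_irrelevant_of_mem 𝒜 hi (Subtype.prop _))

variable {X M : Scheme.{u}} (i : X ⟶ M) (𝒮 : GradedAlg X) (𝒯 : GradedAlg M)

/-- Morphisms of graded algebras `𝒯 → i_* 𝒮` over a morphism `i : X → M` under which the preimages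
`p V` of the affine opens `V` are affine, satisfying the condition under which they
induce a morphism `Proj 𝒮 → Proj 𝒯`. -/
structure HomAlong where
  /-- The preimage of an affine open. -/
  p : M.AffineZariskiSite → X.AffineZariskiSite
  p_mono : Monotone p
  p_eq : ∀ V, (p V).1 = i ⁻¹ᵁ V.1
  /-- The maps `𝒯(V) → 𝒮(i⁻¹ V)`. -/
  φ : ∀ V, 𝒯.gr V →+*ᵍ 𝒮.gr (p V)
  φ_res : ∀ {V V' : M.AffineZariskiSite} (h : V ≤ V'),
    (φ V).comp (𝒯.res h) = (𝒮.res (p_mono h)).comp (φ V')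
  irrelevant_le : ∀ V, HomogeneousIdeal.irrelevant (𝒮.gr (p V)) ≤
    (HomogeneousIdeal.irrelevant (𝒯.gr V)).map (φ V)

variable [𝒮.IsQuasiCoherent] {i 𝒮 𝒯}

lemma opensRange_chart (U : X.AffineZariskiSite) :
    (𝒮.chart U).opensRange = 𝒮.proj ⁻¹ᵁ U.1 := by
  have := 𝒮.projGluingData.toBase_preimage_eq_opensRange_ι U
  exact this.symm.trans (congrArg (𝒮.proj ⁻¹ᵁ ·) (Scheme.Opens.opensRange_ι U.1))

lemma projMap_chart {U V : X.AffineZariskiSite} (h : U ≤ V) :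
    Proj.map (𝒮.res h) (𝒮.irrelevant_le h) ≫ 𝒮.chart V = 𝒮.chart U :=
  Scheme.Cover.trans_map 𝒮.projGluingData.cover (i := U) (j := V)
    (homOfLE h : (U : 𝒮.projGluingData.cover.I₀) ⟶ V)

namespace HomAlong
variable (Φ : HomAlong i 𝒮 𝒯)

/-- The part of `Proj 𝒮` over an affine open of `M`, as a chart of `Proj 𝒮`. -/
def toChart (V : M.AffineZariskiSite) :
    Limits.pullback (𝒮.proj ≫ i) V.1.ι ⟶ Proj (𝒮.gr (Φ.p V)) :=
  IsOpenImmersion.lift (𝒮.chart (Φ.p V)) (Limits.pullback.fst (𝒮.proj ≫ i) V.1.ι) (by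
    have h1 : (𝒮.chart (Φ.p V)).opensRange = 𝒮.proj ⁻¹ᵁ i ⁻¹ᵁ V.1 :=
      (opensRange_chart (Φ.p V)).trans (congrArg (𝒮.proj ⁻¹ᵁ ·) (Φ.p_eq V))
    rw [← Scheme.Hom.coe_opensRange (𝒮.chart (Φ.p V)), h1, Scheme.Pullback.range_fst,
      Scheme.Opens.range_ι]
    exact subset_rfl)

lemma toChart_chart (V : M.AffineZariskiSite) : Φ.toChart V ≫ 𝒮.chart (Φ.p V) =
    Limits.pullback.fst (𝒮.proj ≫ i) V.1.ι :=
  IsOpenImmersion.lift_fac _ _ _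

variable [𝒯.IsQuasiCoherent]

lemma projMap_res {V V' : M.AffineZariskiSite} (h : V ≤ V') :
    Proj.map (Φ.φ V) (Φ.irrelevant_le V) ≫ Proj.map (𝒯.res h) (𝒯.irrelevant_le h) =
      Proj.map (𝒮.res (Φ.p_mono h)) (𝒮.irrelevant_le (Φ.p_mono h)) ≫
        Proj.map (Φ.φ V') (Φ.irrelevant_le V') := by
  rw [← Proj.map_comp, ← Proj.map_comp]
  simp only [Φ.φ_res h]

/-- The morphism from the part of `Proj 𝒮` over an affine open of `M`. -/
def mapOver (V : M.AffineZariskiSite) :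
    Limits.pullback (𝒮.proj ≫ i) V.1.ι ⟶ 𝒯.relProj :=
  Φ.toChart V ≫ Proj.map (Φ.φ V) (Φ.irrelevant_le V) ≫ 𝒯.chart V

lemma comp_mapOver {T : Scheme.{u}} {V V' : M.AffineZariskiSite} (h : V ≤ V')
    (a : T ⟶ Limits.pullback (𝒮.proj ≫ i) V.1.ι) (b : T ⟶ Limits.pullback (𝒮.proj ≫ i) V'.1.ι)
    (hab : a ≫ Limits.pullback.fst _ _ = b ≫ Limits.pullback.fst _ _) :
    b ≫ Φ.mapOver V' = a ≫ Φ.mapOver V := by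
  have h1 : a ≫ Φ.toChart V ≫ Proj.map (𝒮.res (Φ.p_mono h)) (𝒮.irrelevant_le (Φ.p_mono h)) =
      b ≫ Φ.toChart V' := by
    rw [← cancel_mono (𝒮.chart (Φ.p V'))]
    simp only [Category.assoc, projMap_chart, toChart_chart]
    exact hab
  rw [mapOver, mapOver, ← projMap_chart h, ← Category.assoc (Proj.map (Φ.φ V) _), Φ.projMap_res h,
    ← Category.assoc b, ← h1]
  simp only [Category.assoc]

variable (𝒮 i) in
/-- The open cover of `Proj 𝒮` by the preimages of the affine opens of `M`. -/
abbrev coverOver : 𝒮.relProj.OpenCover := (directedCover M).pullback₁ (𝒮.proj ≫ i)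

lemma trans_mapOver {V V' : (coverOver i 𝒮).I₀} (h : V ⟶ V') :
    (coverOver i 𝒮).trans h ≫ Φ.mapOver V' = Φ.mapOver V := by
  refine (Φ.comp_mapOver (V := V) (V' := V')
    (leOfHom (X := M.AffineZariskiSite) h) (𝟙 _) _ ?_).trans (Category.id_comp _)
  exact (Category.id_comp _).trans (Scheme.Cover.trans_map (coverOver i 𝒮) h).symm

/-- The morphism `Proj 𝒮 → Proj 𝒯` induced by a morphism of graded algebras `𝒯 → i_* 𝒮`. -/
def map : 𝒮.relProj ⟶ 𝒯.relProj :=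
  Scheme.OpenCover.glueMorphismsOfLocallyDirected (coverOver i 𝒮) (fun V => Φ.mapOver V)
    fun h => Φ.trans_mapOver h

lemma fst_map (V : M.AffineZariskiSite) :
    Limits.pullback.fst (𝒮.proj ≫ i) V.1.ι ≫ Φ.map = Φ.mapOver V :=
  Scheme.OpenCover.map_glueMorphismsOfLocallyDirected (coverOver i 𝒮) (fun V => Φ.mapOver V)
    (fun h => Φ.trans_mapOver h) V

lemma chart_map (V : M.AffineZariskiSite) :
    𝒮.chart (Φ.p V) ≫ Φ.map = Proj.map (Φ.φ V) (Φ.irrelevant_le V) ≫ 𝒯.chart V := by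
  have h0 : Set.range (𝒮.chart (Φ.p V) ≫ 𝒮.proj ≫ i) ⊆ Set.range V.1.ι := by
    rw [Scheme.Opens.range_ι]
    rintro _ ⟨x, rfl⟩
    have h1 : (𝒮.chart (Φ.p V)).opensRange = 𝒮.proj ⁻¹ᵁ i ⁻¹ᵁ V.1 :=
      (opensRange_chart (Φ.p V)).trans (congrArg (𝒮.proj ⁻¹ᵁ ·) (Φ.p_eq V))
    have h2 : 𝒮.chart (Φ.p V) x ∈ 𝒮.proj ⁻¹ᵁ i ⁻¹ᵁ V.1 := h1 ▸ ⟨x, rfl⟩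
    simpa using h2
  let σ : Proj (𝒮.gr (Φ.p V)) ⟶ Limits.pullback (𝒮.proj ≫ i) V.1.ι :=
    Limits.pullback.lift (𝒮.chart (Φ.p V)) (IsOpenImmersion.lift V.1.ι _ h0)
      (IsOpenImmersion.lift_fac _ _ _).symm
  have h1 : σ ≫ Limits.pullback.fst _ _ = 𝒮.chart (Φ.p V) := Limits.pullback.lift_fst _ _ _
  have h2 : σ ≫ Φ.toChart V = 𝟙 _ := by
    rw [← cancel_mono (𝒮.chart (Φ.p V)), Category.assoc, toChart_chart, h1, Category.id_comp]
  rw [← h1, Category.assoc, fst_map, mapOver, ← Category.assoc, h2, Category.id_comp]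
end HomAlong
end GradedAlg

section Blowups
variable {X Y M : Scheme.{u}} (y : Y ⟶ X)

lemma preim_mono (i : X ⟶ M) [IsAffineHom i] : Monotone (preim i) := by
  rintro V V' ⟨f, hf⟩
  refine ⟨i.app V'.1 f, ?_⟩
  exact (Scheme.preimage_basicOpen i f).symm.trans (congrArg (i ⁻¹ᵁ ·) hf)

lemma sectionMap_resO (i : X ⟶ M) [IsAffineHom i] {V V' : M.AffineZariskiSite} (h : V ≤ V')
    (r : Γ(M, V'.1)) :
    sectionMap i V (resO h r) = resO (preim_mono i h) (sectionMap i V' r) :=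
  congr($(i.naturality (homOfLE (toOpens_mono h)).op) r)

lemma symPull_res [QuasiCompact y] (i : X ⟶ M) [IsAffineHom i] {V V' : M.AffineZariskiSite}
    (h : V ≤ V') : (symPull y i V).comp ((symAlg (y ≫ i).ker).res h) =
      ((symAlg y.ker).res (preim_mono i h)).comp (symPull y i V') := by
  refine symGraded_hom_ext (fun r => ?_) fun x => ?_
  · exact (congrArg _ (symMap_algebraMap _ (ideal_le_comap (y ≫ i).ker h) r)).trans
      ((symMap_algebraMap _ (ideal_le_comap_sectionMap y i V) _).trans
      ((congrArg _ (sectionMap_resO i h r)).trans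
      ((symMap_algebraMap _ (ideal_le_comap y.ker (preim_mono i h)) _).symm.trans
      (congrArg _ (symMap_algebraMap _ (ideal_le_comap_sectionMap y i V') r).symm))))
  · exact (congrArg _ (symMap_ι _ (ideal_le_comap (y ≫ i).ker h) x)).trans
      ((symMap_ι _ (ideal_le_comap_sectionMap y i V) _).trans
      ((congrArg _ (Subtype.ext (sectionMap_resO i h x))).trans
      ((symMap_ι _ (ideal_le_comap y.ker (preim_mono i h)) _).symm.trans
      (congrArg _ (symMap_ι _ (ideal_le_comap_sectionMap y i V') x).symm))))

lemma symMap_surjective {R S : Type*} [CommRing R] [CommRing S] (φ : R →+* S) {I : Ideal R}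
    {J : Ideal S} (h : I ≤ J.comap φ) (hφ : Function.Surjective φ)
    (hI : ∀ z ∈ J, ∃ x ∈ I, φ x = z) : Function.Surjective (symMap φ h) := by
  intro z
  induction z using SymmetricAlgebra.induction with
  | algebraMap s =>
    obtain ⟨r, rfl⟩ := hφ s
    exact ⟨_, symMap_algebraMap φ h r⟩
  | ι z =>
    obtain ⟨x, hx, e⟩ := hI z z.2
    exact ⟨SymmetricAlgebra.ι R I ⟨x, hx⟩, by rw [symMap_ι]; congr 1; exact Subtype.ext e⟩
  | mul a b ha hb =>
    obtain ⟨a, rfl⟩ := ha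
    obtain ⟨b, rfl⟩ := hb
    exact ⟨a * b, map_mul _ _ _⟩
  | add a b ha hb =>
    obtain ⟨a, rfl⟩ := ha
    obtain ⟨b, rfl⟩ := hb
    exact ⟨a + b, map_add _ _ _⟩

lemma symPull_surjective [QuasiCompact y] (i : X ⟶ M) [IsClosedImmersion i]
    (V : M.AffineZariskiSite) : Function.Surjective (symPull y i V) := by
  have hs : Function.Surjective (sectionMap i V) := i.app_surjective V.1 V.2
  refine symMap_surjective _ (ideal_le_comap_sectionMap y i V) hs fun z hz => ?_
  obtain ⟨x, rfl⟩ := hs z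
  refine ⟨x, ?_, rfl⟩
  simp only [idealOf, Scheme.Hom.ker_apply, RingHom.mem_ker] at hz ⊢
  rw [Scheme.Hom.comp_app]
  exact hz

lemma symToRees_surjective {R : Type*} [CommRing R] (I : Ideal R) :
    Function.Surjective (symToRees I) := by
  suffices h : ∀ p ∈ reesAlgebra I, ∃ x, (symToRees I x : Polynomial R) = p from fun p =>
    let ⟨x, hx⟩ := h p p.2
    ⟨x, Subtype.ext hx⟩
  intro p hp
  rw [← adjoin_monomial_eq_reesAlgebra] at hp
  induction hp using Algebra.adjoin_induction with
  | mem p hp =>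
    obtain ⟨r, hr, rfl⟩ := hp
    exact ⟨SymmetricAlgebra.ι R I ⟨r, hr⟩, by rw [symToRees_ι]; rfl⟩
  | algebraMap r => exact ⟨algebraMap R _ r, by rw [symToRees_algebraMap]; rfl⟩
  | add p q _ _ hp hq =>
    obtain ⟨a, rfl⟩ := hp
    obtain ⟨b, rfl⟩ := hq
    exact ⟨a + b, by rw [map_add]; rfl⟩
  | mul p q _ _ hp hq =>
    obtain ⟨a, rfl⟩ := hp
    obtain ⟨b, rfl⟩ := hq
    exact ⟨a * b, by rw [map_mul]; rfl⟩

lemma symToRees_symMap {R S : Type*} [CommRing R] [CommRing S] (φ : R →+* S) {I : Ideal R}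
    {J : Ideal S} (h : I ≤ J.comap φ) :
    (symToRees J).comp (symMap φ h) = (reesMap φ h).comp (symToRees I) := by
  refine symGraded_hom_ext (fun r => ?_) fun x => ?_
  · rw [GradedRingHom.comp_apply, GradedRingHom.comp_apply, symMap_algebraMap,
      symToRees_algebraMap, symToRees_algebraMap]
    ext1; simp
  · rw [GradedRingHom.comp_apply, GradedRingHom.comp_apply, symMap_ι, symToRees_ι, symToRees_ι]
    ext1; simp [reesι]

/-- The symmetric blow-up: the Proj of the symmetric algebra of an ideal sheaf. -/
abbrev sBl (J : X.IdealSheafData) : Scheme.{u} := (symAlg J).relProj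

/-- The blow-up: the Proj of the Rees algebra of an ideal sheaf. -/
abbrev Bl (J : X.IdealSheafData) : Scheme.{u} := (reesAlg J).relProj

/-- The morphism `Bl → sBl` induced by `Sym → Rees`. -/
def blToSBl (J : X.IdealSheafData) : Bl J ⟶ sBl J :=
  GradedAlg.HomAlong.map (i := 𝟙 X)
    { p := id
      p_mono := monotone_id
      p_eq := fun _ => rfl
      φ := fun U => symToRees (idealOf J U)
      φ_res := fun h => symToRees_symMap _ (ideal_le_comap J h)
      irrelevant_le := fun U => GradedAlg.irrelevant_le_of_surjective _
        (symToRees_surjective (idealOf J U)) }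

/-- For closed embeddings `Y ⊂ X ⊂ M`, the morphism `sBl_Y X → sBl_Y M` induced by
`Sym_{𝒪_M}(J_{Y,M}) → Sym_{𝒪_X}(J_{Y,X})`. -/
def sBlMap [QuasiCompact y] (i : X ⟶ M) [IsClosedImmersion i] : sBl y.ker ⟶ sBl (y ≫ i).ker :=
  GradedAlg.HomAlong.map (i := i)
    { p := preim i
      p_mono := preim_mono i
      p_eq := fun _ => rfl
      φ := fun V => symPull y i V
      φ_res := fun h => symPull_res y i h
      irrelevant_le := fun V => GradedAlg.irrelevant_le_of_surjective _
        (symPull_surjective y i V) }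

end Blowups

section QuasiSymmetricBlowup
open HomogeneousIdeal

namespace GradedAlg
variable {X : Scheme.{u}} {𝒮 : GradedAlg X} (𝒦 : Set 𝒮.IdealFamily)

lemma toLimQuot_of_mem {U : X.AffineZariskiSite} {d : ℕ} {a : 𝒮.obj U} (ha : a ∈ 𝒮.gr U d) :
    toLimQuot 𝒦 U a = DirectSum.of (fun d => limPart 𝒦 U d) d
      ⟨fun K => Ideal.Quotient.mk (K.1.ideal U) a, fun _ => ⟨a, ha, rfl⟩, fun _ _ _ => rfl⟩ := by
  exact toSum_of_mem (limPart 𝒦 U) _ _ ha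

lemma toLimQuot_res {U V : X.AffineZariskiSite} (h : U ≤ V) :
    (toLimQuot 𝒦 U).comp (𝒮.res h) = ((limQuot 𝒦).res h).comp (toLimQuot 𝒦 V) := by
  refine GradedRingHom.ext fun x => ?_
  change toLimQuot 𝒦 U (𝒮.res h x) = (limQuot 𝒦).res h (toLimQuot 𝒦 V x)
  induction x using DirectSum.Decomposition.inductionOn (𝒮.gr V) with
  | zero => simp only [map_zero]
  | @homogeneous d m =>
    refine (toLimQuot_of_mem 𝒦 (a := 𝒮.res h m) ((𝒮.res h).map_mem m.2)).trans ?_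
    refine Eq.trans ?_ (congrArg ((limQuot 𝒦).res h) (toLimQuot_of_mem 𝒦 m.2).symm)
    exact (sumMap_of _ (prodRes_mem 𝒦 h) d ⟨fun K => Ideal.Quotient.mk (K.1.ideal V) (m : 𝒮.obj V),
      fun _ => ⟨m, m.2, rfl⟩, fun _ _ _ => rfl⟩).symm
  | add a b ha hb => rw [map_add, map_add, map_add, map_add, ha, hb]

end GradedAlg

variable {k : Type u} [Field k] {X Y : Scheme.{u}} (s : X ⟶ Spec (.of k)) (y : Y ⟶ X)

/-- The quasi-symmetric blow-up of `X` along `Y`: the Proj of the quasi-symmetric algebra. -/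
abbrev qBl [QuasiCompact y] [(qSymAlg s y).IsQuasiCoherent] : Scheme.{u} := (qSymAlg s y).relProj

/-- The canonical morphism `qBl_Y X → sBl_Y X`, induced by the canonical map from the symmetric
algebra to the quasi-symmetric algebra. -/
def qBlToSBl [QuasiCompact y] [(qSymAlg s y).IsQuasiCoherent]
    (h : ∀ U, irrelevant ((qSymAlg s y).gr U) ≤
      (irrelevant ((symAlg y.ker).gr U)).map (symToQSym s y U)) : qBl s y ⟶ sBl y.ker :=
  GradedAlg.HomAlong.map (i := 𝟙 X)
    { p := id
      p_mono := monotone_id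
      p_eq := fun _ => rfl
      φ := fun U => symToQSym s y U
      φ_res := fun h => GradedAlg.toLimQuot_res (embeddingKernels s y) h
      irrelevant_le := h }

/-- A subscheme `ι : Z → sBl_Y X` admits an embedding in `Bl_Y M` for some scheme `M` of finite type
over `k` containing `X` as a closed subscheme, compatibly with the projections to `X` and `M`
and with the canonical closed embeddings `sBl_Y X → sBl_Y M ← Bl_Y M` (so that the structure of
`Z` as a subscheme of `sBl_Y X` and its structure as a subscheme of `Bl_Y M` induce the same maps
from `J_{Y,M}` to the tautological line bundle on `Z`). -/
def AdmitsEmbedding [QuasiCompact y] {Z : Scheme.{u}} (ι : Z ⟶ sBl y.ker) : Prop :=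
  ∃ (M : Scheme.{u}) (t : M ⟶ Spec (.of k)) (i : X ⟶ M) (_ : LocallyOfFiniteType t)
    (_ : QuasiCompact t) (_ : IsClosedImmersion i) (e : Z ⟶ Bl (y ≫ i).ker),
    i ≫ t = s ∧ IsImmersion e ∧
    e ≫ (reesAlg (y ≫ i).ker).proj = ι ≫ (symAlg y.ker).proj ≫ i ∧
    e ≫ blToSBl (y ≫ i).ker = ι ≫ sBlMap y i

end QuasiSymmetricBlowup

end QSym
end

/-! The key point is that a smooth ambient scheme imposes the fewest relations. For an embedding of
`X` in `M`, the algebra `qSym` is the quotient of `Sym_X(J_{Y,X})` by the image of the kernel of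
`Sym_M(J_{Y,M}) → Rees_M(J_{Y,M})`, that is, by the polynomial relations between elements of
`J_{Y,M}` that hold in `𝒪_M`. If `M₀` is smooth over `k`, these relations, restricted to `X`, lie
among those coming from any other `M`.

Locally this is `map_relIdeal_le_of_formallySmooth`. Let `R` be smooth with a map to `A`, and let `A
= P/c` with `P` Noetherian. Formal smoothness lifts `R → A` to `P/c^(n+1)`, so a relation `F` of
degree `d` over `R` becomes a relation over `P` up to an error in `c^(n+1) ∩ J^d`. For `n` large,
Artin–Rees puts the error in `c J^d`. It can then be removed by an element of `Sym_P(J)` with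
coefficients in `c`, which is invisible over `A`.

Consequently the kernel belonging to a smooth `M₀` is the least member of the inverse system
(`qSymKer_le_of_smooth`), and the limit is, degree by degree, the quotient by this kernel. Comparing
`M₀` with itself shows that the kernel does not depend on the charts of `M₀` used to compute it.
This gives quasi-coherence (`exists_pow_mul_mem_qSymKer`) and hence a closed embedding `qBl → sBl`.

For the embedding in a blow-up, the relations over `M₀` die in `qSym`, so `Sym_{M₀} → qSym` descends
to a surjection from `Rees_{M₀}`, which embeds `qBl` in `Bl_Y M₀`. For maximality, let `Z` map
compatibly to `sBl_Y X` and `Bl_Y M`. A homogeneous element of the least kernel also lies in the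
kernel for `M`, so it lifts to a relation over `M`. Relations over `M` vanish on `Bl_Y M`, hence on
`Z`, and `Z` factors through `qBl` (`exists_factorization_projMap`). -/

noncomputable section
namespace QSym

open DirectSum
open Scheme.AffineZariskiSite (toOpens toOpens_mono basicOpen_le directedCover restrictIsoSpec)

/-! ### Relations between the symmetric and Rees algebras of an ideal. -/

section SymRees
variable {R S T A P : Type*} [CommRing R] [CommRing S] [CommRing T] [CommRing A] [CommRing P]

/-- The kernel of the canonical surjection from the symmetric algebra of an ideal to its Rees
algebra. -/
def relIdeal (I : Ideal R) : Ideal (SymmetricAlgebra R I) := RingHom.ker (symToRees I).toRingHom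

lemma mem_relIdeal {I : Ideal R} {x : SymmetricAlgebra R I} :
    x ∈ relIdeal I ↔ symToRees I x = 0 := Iff.rfl

/-- Base change of a quotient is a quotient: if `N` is the extension to `A` of the kernel of `R →
S`, then `A → A ⧸ N` factors through `A ⊗ S`, which bounds the kernel from above. -/
lemma ker_includeLeftRingHom_of_surjective [Algebra R A] [Algebra R S]
    (h : Function.Surjective (algebraMap R S)) :
    RingHom.ker (Algebra.TensorProduct.includeLeftRingHom : A →+* TensorProduct R A S) =
      (RingHom.ker (algebraMap R S)).map (algebraMap R A) := by
  refine le_antisymm ?_ (Ideal.map_le_iff_le_comap.mpr fun x hx => ?_)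
  · intro a ha
    let N := (RingHom.ker (algebraMap R S)).map (algebraMap R A)
    let g : R →ₐ[R] A ⧸ N := Algebra.ofId R (A ⧸ N)
    let σ : S →ₐ[R] A ⧸ N := AlgHom.liftOfSurjective (Algebra.ofId R S) h g (by
      intro r hr
      change algebraMap R (A ⧸ N) r = 0
      rw [IsScalarTower.algebraMap_apply R A (A ⧸ N)]
      exact Ideal.Quotient.eq_zero_iff_mem.mpr (Ideal.mem_map_of_mem _ hr))
    let τ : TensorProduct R A S →ₐ[R] A ⧸ N :=
      Algebra.TensorProduct.lift (Ideal.Quotient.mkₐ R N) σ fun _ _ => Commute.all _ _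
    have h1 : τ (a ⊗ₜ 1) = Ideal.Quotient.mk N a := by
      simp [τ]
    have h2 : a ⊗ₜ[R] (1 : S) = 0 := ha
    rw [h2, map_zero] at h1
    exact Ideal.Quotient.eq_zero_iff_mem.mp h1.symm
  · change algebraMap R A x ⊗ₜ[R] (1 : S) = 0
    rw [Algebra.algebraMap_eq_smul_one, TensorProduct.smul_tmul, ← Algebra.algebraMap_eq_smul_one,
      RingHom.mem_ker.mp hx, TensorProduct.tmul_zero]

/-- Trades the tensor product for an extended ideal. From here on only ideals of relations are
transported along ring maps. -/
lemma qSymKernel_eq_map (φ : R →+* A) {I : Ideal R} {𝔞 : Ideal A} (h : I ≤ 𝔞.comap φ) :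
    qSymKernel φ h = (relIdeal I).map (symMap φ h).toRingHom := by
  let := (symMap φ h).toRingHom.toAlgebra
  let := (symToRees I).toRingHom.toAlgebra
  exact ker_includeLeftRingHom_of_surjective (R := SymmetricAlgebra R I)
    (A := SymmetricAlgebra A 𝔞) (S := reesAlgebra I) (symToRees_surjective I)

lemma symMap_comp (φ : R →+* S) (ψ : S →+* T) {I : Ideal R} {J : Ideal S} {K : Ideal T}
    (h : I ≤ J.comap φ) (h' : J ≤ K.comap ψ) (h'' : I ≤ K.comap (ψ.comp φ)) :
    (symMap ψ h').comp (symMap φ h) = symMap (ψ.comp φ) h'' := by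
  refine symGraded_hom_ext (fun r => ?_) fun x => ?_
  · rw [GradedRingHom.comp_apply, symMap_algebraMap, symMap_algebraMap, symMap_algebraMap]; rfl
  · rw [GradedRingHom.comp_apply, symMap_ι, symMap_ι, symMap_ι]; rfl

/-- The composite is a separate map `χ` because in the applications one ring map factors in two
ways, and the factorizations agree only up to a proved equality. -/
lemma symMap_symMap (φ : R →+* S) (ψ : S →+* T) {χ : R →+* T} (e : ψ.comp φ = χ) {I : Ideal R}
    {J : Ideal S} {K : Ideal T} (h : I ≤ J.comap φ) (h' : J ≤ K.comap ψ) (h'' : I ≤ K.comap χ)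
    (x : SymmetricAlgebra R I) : symMap ψ h' (symMap φ h x) = symMap χ h'' x := by
  subst e
  exact congr($(symMap_comp φ ψ h h' h'') x)

lemma map_symMap_map_symMap (φ : R →+* S) (ψ : S →+* T) {χ : R →+* T} (e : ψ.comp φ = χ)
    {I : Ideal R} {J : Ideal S} {K : Ideal T} (h : I ≤ J.comap φ) (h' : J ≤ K.comap ψ)
    (h'' : I ≤ K.comap χ) (N : Ideal (SymmetricAlgebra R I)) :
    (N.map (symMap φ h).toRingHom).map (symMap ψ h').toRingHom =
      N.map (symMap χ h'').toRingHom := by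
  rw [Ideal.map_map]
  congr 1
  exact RingHom.ext fun x => symMap_symMap φ ψ e h h' h'' x

lemma symToRees_symMap_apply (φ : R →+* S) {I : Ideal R} {J : Ideal S} (h : I ≤ J.comap φ)
    (x : SymmetricAlgebra R I) : symToRees J (symMap φ h x) = reesMap φ h (symToRees I x) :=
  congr($(symToRees_symMap φ h) x)

lemma decompose_mem_relIdeal {I : Ideal R} {x : SymmetricAlgebra R I} (hx : x ∈ relIdeal I)
    (d : ℕ) : (DirectSum.decompose (symGrading R I) x d : SymmetricAlgebra R I) ∈ relIdeal I := by
  rw [mem_relIdeal] at hx ⊢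
  rw [GradedRingHom.map_directSumDecompose, hx]
  simp

/-- Both `Sym` and `Rees` localize at `f`. After clearing denominators, a relation over `S` comes
from `Sym_R(I)`; its image in the Rees algebra is killed by a power of `f`, and multiplying by that
power, a unit over `S`, gives a relation over `R`. -/
lemma relIdeal_le_map_of_isAwayMap {φ : R →+* S} {f : R} {I : Ideal R} {J : Ideal S}
    (h : I ≤ J.comap φ) (hφ : IsAwayMap φ f) (hJ : I.map φ = J) :
    relIdeal J ≤ (relIdeal I).map (symMap φ h).toRingHom := by
  intro z hz
  have hs := isAwayMap_iff.mp (isAwayMap_symMap h hφ hJ)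
  have hr := isAwayMap_iff.mp (isAwayMap_reesMap h hφ hJ)
  obtain ⟨x, n, e⟩ := hs.2.1 z
  have h1 : reesMap φ h (symToRees I x) = 0 := by
    rw [← symToRees_symMap_apply]
    change symToRees J ((symMap φ h).toRingHom x) = 0
    rw [← e, map_mul, mem_relIdeal.mp hz, zero_mul]
  obtain ⟨m, hm⟩ := hr.2.2 _ h1
  have h2 : algebraMap R (SymmetricAlgebra R I) f ^ m * x ∈ relIdeal I := by
    rw [mem_relIdeal, map_mul, map_pow, symToRees_algebraMap, hm]
  have hu := hs.1
  rw [← Ideal.mul_unit_mem_iff_mem _ (hu.pow (n + m)), pow_add, ← mul_assoc, e, ← map_pow,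
    ← map_mul, mul_comm]
  exact Ideal.mem_map_of_mem _ h2

/-- For `p = c q` with `c` in the kernel and `q ∈ I ^ d`, lift `q t ^ d` arbitrarily and multiply by
`c`: the coefficient `c` becomes zero over `A`. This produces the correction term in the proof of
`map_relIdeal_le_of_formallySmooth`. -/
lemma exists_lift_of_mem_mul (π : P →+* A) {I : Ideal P} {𝔞 : Ideal A} (h : I ≤ 𝔞.comap π) {d : ℕ}
    {p : P} (hp : p ∈ RingHom.ker π * I ^ d) :
    ∃ G, (symToRees I G : Polynomial P) = Polynomial.monomial d p ∧ symMap π h G = 0 := by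
  induction hp using Submodule.mul_induction_on' with
  | mem_mul_mem c hc q hq =>
    obtain ⟨G, hG⟩ := symToRees_surjective I
      ⟨Polynomial.monomial d q, reesAlgebra.monomial_mem.mpr hq⟩
    refine ⟨algebraMap P _ c * G, ?_, ?_⟩
    · rw [map_mul, symToRees_algebraMap, hG]
      simp [Polynomial.C_mul_monomial]
    · rw [map_mul, symMap_algebraMap, RingHom.mem_ker.mp hc, map_zero, zero_mul]
  | add x hx y hy ihx ihy =>
    obtain ⟨G, hG, hG'⟩ := ihx
    obtain ⟨H, hH, hH'⟩ := ihy
    refine ⟨G + H, ?_, ?_⟩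
    · rw [map_add, map_add, ← hG, ← hH]; rfl
    · rw [map_add, hG', hH', add_zero]

/-- A consequence of the Artin–Rees lemma. -/
lemma exists_pow_inf_le_mul [IsNoetherianRing P] (c J : Ideal P) :
    ∃ n : ℕ, c ^ n ⊓ J ≤ c * J := by
  obtain ⟨k, hk⟩ := Ideal.exists_pow_inf_eq_pow_smul c J
  -- One step past the Artin–Rees bound `k`, the intersection is `c (c ^ k ⊓ J)`, which carries the
  -- required factor `c`.
  refine ⟨k + 1, ?_⟩
  have := hk (k + 1) (Nat.le_succ k)
  simp only [smul_eq_mul, Ideal.mul_top, Nat.add_sub_cancel_left, pow_one] at this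
  rw [this]
  exact Ideal.mul_mono_right inf_le_right

/-- The symmetric relations of an ideal of a formally smooth algebra hold modulo the relations
coming from any other presentation. -/
theorem map_relIdeal_le_of_formallySmooth {k : Type*} [CommRing k] [Algebra k R] [Algebra k P]
    [Algebra.FormallySmooth k R] [IsNoetherianRing P] (ρ : R →+* A) (π : P →+* A)
    (hk : ρ.comp (algebraMap k R) = π.comp (algebraMap k P)) (hπ : Function.Surjective π)
    {I : Ideal R} {J : Ideal P} {𝔞 : Ideal A} (hI : I ≤ 𝔞.comap ρ) (hJ : J ≤ 𝔞.comap π)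
    (hJ' : 𝔞.comap π ≤ J) :
    (relIdeal I).map (symMap ρ hI).toRingHom ≤ (relIdeal J).map (symMap π hJ).toRingHom := by
  obtain rfl : J = 𝔞.comap π := le_antisymm hJ hJ'
  refine Ideal.map_le_iff_le_comap.mpr fun F hF => ?_
  classical
  -- The kernel is homogeneous, so one may treat each degree `d` separately; the Artin–Rees exponent
  -- below depends on `d`.
  rw [← DirectSum.sum_support_decompose (symGrading R I) F]
  refine sum_mem fun d _ => ?_
  have hF' := decompose_mem_relIdeal hF d
  generalize DirectSum.decompose (symGrading R I) F d = F₀ at hF' ⊢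
  clear hF
  obtain ⟨F, hFd⟩ := F₀
  change F ∈ relIdeal I at hF'
  change symMap ρ hI F ∈ (relIdeal (𝔞.comap π)).map (symMap π hJ).toRingHom
  let c := RingHom.ker π
  obtain ⟨n, hn⟩ := exists_pow_inf_le_mul c ((𝔞.comap π) ^ d)
  -- The exponent `n + 1` is positive even when `n = 0`, so `c ^ (n + 1) ≤ c` and `π` factors
  -- through the quotient.
  let q : P →+* P ⧸ c ^ (n + 1) := Ideal.Quotient.mk _
  let πn : P ⧸ c ^ (n + 1) →+* A := Ideal.Quotient.lift _ π fun x hx =>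
    Ideal.pow_le_self (Nat.succ_ne_zero n) hx
  have hπn : πn.comp q = π := Ideal.Quotient.lift_comp_mk _ _ _
  let : Algebra k A := (π.comp (algebraMap k P)).toAlgebra
  let ρ' : R →ₐ[k] A := { ρ with commutes' := fun r => congr($hk r) }
  let π' : P ⧸ c ^ (n + 1) →ₐ[k] A := { πn with commutes' := fun r => rfl }
  have hnil : IsNilpotent (RingHom.ker (π' : P ⧸ c ^ (n + 1) →+* A)) := by
    refine ⟨n + 1, ?_⟩
    have : RingHom.ker (π' : P ⧸ c ^ (n + 1) →+* A) = c.map q := by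
      refine le_antisymm (fun x hx => ?_) (Ideal.map_le_iff_le_comap.mpr fun x hx => ?_)
      · obtain ⟨x, rfl⟩ := Ideal.Quotient.mk_surjective x
        exact Ideal.mem_map_of_mem q hx
      · exact hx
    rw [this, ← Ideal.map_pow]
    exact Ideal.map_quotient_self _
  have hπ' : Function.Surjective π' := fun a => by
    obtain ⟨p, rfl⟩ := hπ a
    exact ⟨q p, rfl⟩
  -- The only use of smoothness: `ρ` lifts along the nilpotent thickening `P ⧸ c ^ (n + 1) → A`.
  let τ : R →ₐ[k] P ⧸ c ^ (n + 1) := Algebra.FormallySmooth.liftOfSurjective ρ' π' hπ' hnil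
  have hτ : πn.comp τ.toRingHom = ρ := RingHom.ext fun r =>
    Algebra.FormallySmooth.liftOfSurjective_apply ρ' π' hπ' hnil r
  have h1 : I ≤ (𝔞.comap πn).comap τ.toRingHom := by
    rw [Ideal.comap_comap, hτ]; exact hI
  have h2 : 𝔞.comap π ≤ (𝔞.comap πn).comap q := by rw [Ideal.comap_comap, hπn]
  have h3 : 𝔞.comap πn ≤ 𝔞.comap πn := le_rfl
  obtain ⟨F₁, hF₁⟩ := symMap_surjective q h2 Ideal.Quotient.mk_surjective (fun z hz => by
    obtain ⟨z, rfl⟩ := Ideal.Quotient.mk_surjective z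
    exact ⟨z, hz, rfl⟩) (symMap τ.toRingHom h1 F)
  -- An arbitrary lift need not be homogeneous. Its degree `d` part is still a lift, because the
  -- lifted element has degree `d`.
  let F₂ : SymmetricAlgebra P (𝔞.comap π) := DirectSum.decompose (symGrading P _) F₁ d
  have hF₂ : symMap q h2 F₂ = symMap τ.toRingHom h1 F := by
    rw [GradedRingHom.map_directSumDecompose, hF₁]
    exact DirectSum.decompose_of_mem_same _ ((symMap τ.toRingHom h1).map_mem hFd)
  have hF₂d : F₂ ∈ symGrading P (𝔞.comap π) d := Subtype.prop _
  have h4 := (mem_reesGrading_iff _).mp ((symToRees (𝔞.comap π)).map_mem hF₂d)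
  set p := (symToRees (𝔞.comap π) F₂ : Polynomial P).coeff d with hp
  -- Modulo `c ^ (n + 1)`, the Rees image of `F₂` is that of `F`, which is zero because `F` is a
  -- relation over `R`.
  have h5 : p ∈ c ^ (n + 1) := by
    rw [← Ideal.Quotient.eq_zero_iff_mem]
    change q p = 0
    rw [hp, ← Polynomial.coeff_map, ← coe_reesMap q h2, ← symToRees_symMap_apply, hF₂,
      symToRees_symMap_apply, mem_relIdeal.mp hF', map_zero]
    rfl
  have h6 : p ∈ c * (𝔞.comap π) ^ d :=
    hn ⟨Ideal.pow_le_pow_right (Nat.le_succ n) h5, (symToRees (𝔞.comap π) F₂).2 d⟩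
  obtain ⟨G, hG, hG'⟩ := exists_lift_of_mem_mul π le_rfl h6
  -- `F₂` and `G` have the same Rees image `p t ^ d`, so their difference is a true relation over
  -- `P`; over `A` it agrees with `F`, since `G` vanishes there.
  have h7 : F₂ - G ∈ relIdeal (𝔞.comap π) := by
    rw [mem_relIdeal, map_sub, sub_eq_zero]
    exact Subtype.ext (h4.trans hG.symm)
  have h8 : symMap π hJ (F₂ - G) = symMap ρ hI F := by
    rw [map_sub, hG', sub_zero, ← symMap_symMap q πn hπn h2 h3 hJ, hF₂]
    exact symMap_symMap _ _ hτ h1 h3 hI F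
  rw [← h8]
  exact Ideal.mem_map_of_mem (symMap π hJ).toRingHom h7

end SymRees
-- Local nature of membership in ideals of quasi-coherent graded algebras.
section LocalMembership

lemma IsAwayMap.exists_pow_mul_mem {R S : Type*} [CommRing R] [CommRing S] {ψ : R →+* S} {g : R}
    (hψ : IsAwayMap ψ g) {N : Ideal R} {a : R} (ha : ψ a ∈ N.map ψ) : ∃ n : ℕ, g ^ n * a ∈ N := by
  obtain ⟨x, hx, n, e⟩ := hψ.exists_mem_of_mem_map ha
  obtain ⟨m, hm⟩ := (isAwayMap_iff.mp hψ).2.2 (a * g ^ n - x)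
    (by rw [map_sub, map_mul, map_pow, e, sub_self])
  refine ⟨m + n, ?_⟩
  have : g ^ (m + n) * a = g ^ m * (a * g ^ n - x) + g ^ m * x := by ring
  rw [this, hm, zero_add]
  exact N.mul_mem_left _ hx

namespace GradedAlg
variable {X : Scheme.{u}} (𝒮 : GradedAlg X)

lemma res_res_apply {U V W : X.AffineZariskiSite} (h : U ≤ V) (h' : V ≤ W) (a : 𝒮.obj W) :
    𝒮.res h (𝒮.res h' a) = 𝒮.res (h.trans h') a :=
  congr($(𝒮.res_res h h') a)

lemma map_res_map_res {U V W : X.AffineZariskiSite} (h : U ≤ V) (h' : V ≤ W)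
    (N : Ideal (𝒮.obj W)) : (N.map (𝒮.res h').toRingHom).map (𝒮.res h).toRingHom =
      N.map (𝒮.res (h.trans h')).toRingHom := by
  rw [Ideal.map_map, ← 𝒮.res_res h h']
  rfl

lemma isAwayMap_res [𝒮.IsQuasiCoherent] {U V : X.AffineZariskiSite} (h : U ≤ V) (f : Γ(X, V.1))
    (hf : X.basicOpen f = U.1) : IsAwayMap (𝒮.res h).toRingHom (algebraMap _ (𝒮.obj V) f) := by
  obtain rfl : V.basicOpen f = U := Subtype.ext hf
  exact IsQuasiCoherent.isAwayMap V f

/-- The functions `r` with `r a ∈ N` form an ideal `T`. Near each point the hypothesis and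
quasi-coherence give an `f`, nonvanishing there, with a power in `T`. Thus the radical of `T` is the
unit ideal, and `1 ∈ T`. -/
lemma mem_of_locally_mem [𝒮.IsQuasiCoherent] {W : X.AffineZariskiSite} (N : Ideal (𝒮.obj W))
    (a : 𝒮.obj W) (H : ∀ x ∈ W.1, ∃ (W' : X.AffineZariskiSite) (h : W' ≤ W), x ∈ W'.1 ∧
      𝒮.res h a ∈ N.map (𝒮.res h).toRingHom) : a ∈ N := by
  let T : Ideal Γ(X, W.1) := Submodule.comap (LinearMap.toSpanSingleton Γ(X, W.1) (𝒮.obj W) a)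
    (N.restrictScalars Γ(X, W.1))
  have hT (r : Γ(X, W.1)) : r ∈ T ↔ algebraMap _ (𝒮.obj W) r * a ∈ N := by
    rw [← Algebra.smul_def]; rfl
  have h1 : W.1 ≤ ⨆ f : (T.radical : Set Γ(X, W.1)), X.basicOpen (f : Γ(X, W.1)) := by
    intro x hx
    obtain ⟨W', h, hxW', ha⟩ := H x hx
    obtain ⟨f, hf⟩ := id h
    obtain ⟨n, hn⟩ := (𝒮.isAwayMap_res h f hf).exists_pow_mul_mem ha
    rw [← map_pow, ← hT] at hn
    exact TopologicalSpace.Opens.mem_iSup.mpr ⟨⟨f, n, hn⟩, hf.symm ▸ hxW'⟩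
  rw [W.2.self_le_iSup_basicOpen_iff, Ideal.span_eq, Ideal.radical_eq_top] at h1
  have := (hT 1).mp (h1 ▸ Submodule.mem_top)
  rwa [map_one, one_mul] at this

end GradedAlg

lemma exists_common_basicOpen {X : Scheme.{u}} (U V : X.AffineZariskiSite) {x : X} (hU : x ∈ U.1)
    (hV : x ∈ V.1) : ∃ W : X.AffineZariskiSite, W ≤ U ∧ W ≤ V ∧ x ∈ W.1 := by
  obtain ⟨f, g, e, hx⟩ := exists_basicOpen_le_affine_inter U.2 V.2 x ⟨hU, hV⟩
  exact ⟨U.basicOpen f, ⟨f, rfl⟩, ⟨g, e.symm⟩, hx⟩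

lemma exists_affineZariskiSite_mem {X : Scheme.{u}} (x : X) :
    ∃ U : X.AffineZariskiSite, x ∈ U.1 := by
  obtain ⟨_, ⟨U, hU, rfl⟩, hx, -⟩ :=
    X.isBasis_affineOpens.exists_subset_of_mem_open (Set.mem_univ x) isOpen_univ
  exact ⟨⟨U, hU⟩, hx⟩

end LocalMembership

/-! ### Comparison of the kernels belonging to different embeddings of `X`. -/

section ExtendedKernel
variable {X Y M M₀ : Scheme.{u}} (y : Y ⟶ X) [QuasiCompact y]

section
variable (i : X ⟶ M) [IsAffineHom i]

/-- The ideal of `Sym_{𝒪_X}(J_{Y,X})(W)` generated by the kernel of the surjection to the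
quasi-symmetric algebra over an affine open `V` of `M` whose preimage contains `W`. -/
def extKernel (V : M.AffineZariskiSite) {W : X.AffineZariskiSite} (hV : W ≤ preim i V) :
    Ideal ((symAlg y.ker).obj W) :=
  (qSymKernel (sectionMap i V) (ideal_le_comap_sectionMap y i V)).map
    ((symAlg y.ker).res hV).toRingHom

lemma mem_qSymKer {U : X.AffineZariskiSite} {a : (symAlg y.ker).obj U} :
    a ∈ (qSymKer y i).ideal U ↔ ∀ (V : M.AffineZariskiSite) (W : X.AffineZariskiSite) (hU : W ≤ U)
      (hV : W ≤ preim i V), (symAlg y.ker).res hU a ∈ extKernel y i V hV :=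
  Iff.rfl

lemma map_res_extKernel (V : M.AffineZariskiSite) {W W' : X.AffineZariskiSite} (h : W' ≤ W)
    (hV : W ≤ preim i V) : (extKernel y i V hV).map ((symAlg y.ker).res h).toRingHom =
      extKernel y i V (h.trans hV) :=
  (symAlg y.ker).map_res_map_res h hV _

lemma extKernel_self (V : M.AffineZariskiSite) : extKernel y i V le_rfl =
    qSymKernel (sectionMap i V) (ideal_le_comap_sectionMap y i V) := by
  rw [extKernel, (symAlg y.ker).res_self]
  exact Ideal.map_id _

lemma ideal_le_comap_resO_sectionMap (V : M.AffineZariskiSite) {W : X.AffineZariskiSite}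
    (hV : W ≤ preim i V) :
    idealOf (y ≫ i).ker V ≤ (idealOf y.ker W).comap ((resO hV).comp (sectionMap i V)) :=
  fun _ hr => ideal_le_comap y.ker hV (ideal_le_comap_sectionMap y i V hr)

lemma extKernel_eq_map (V : M.AffineZariskiSite) {W : X.AffineZariskiSite} (hV : W ≤ preim i V) :
    extKernel y i V hV = (relIdeal (idealOf (y ≫ i).ker V)).map
      (symMap ((resO hV).comp (sectionMap i V))
        (ideal_le_comap_resO_sectionMap y i V hV)).toRingHom := by
  rw [extKernel, qSymKernel_eq_map]
  exact map_symMap_map_symMap _ _ rfl (ideal_le_comap_sectionMap y i V)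
    (ideal_le_comap y.ker hV) _ _

/-- Makes the restrictions to `X` from two different ambient schemes linear over the same base ring,
as the lifting argument requires. -/
lemma resO_sectionMap_appLE {S : Scheme.{u}} {s : X ⟶ S} {t : M ⟶ S} (h : i ≫ t = s)
    (V : M.AffineZariskiSite) {W : X.AffineZariskiSite} (hV : W ≤ preim i V) :
    ((resO hV).comp (sectionMap i V)).comp (t.appLE ⊤ V.1 le_top).hom =
      (s.appLE ⊤ W.1 le_top).hom := by
  subst h
  have h1 : W.1 ≤ i ⁻¹ᵁ V.1 := toOpens_mono hV
  have : t.appLE ⊤ V.1 le_top ≫ i.app V.1 ≫ X.presheaf.map (homOfLE h1).op =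
      (i ≫ t).appLE ⊤ W.1 le_top := by
    rw [← Scheme.Hom.appLE_comp_appLE i t ⊤ V.1 W.1 le_top h1]
    rfl
  exact congr(($this).hom)

end

/-- As `i` is a closed immersion, `W` is the preimage of a basic open of `V`, so `𝒪_X(W)` is a
quotient of the Noetherian ring of that basic open. `map_relIdeal_le_of_formallySmooth` applies
there, and the relations over the basic open are generated by those over `V`. -/
lemma extKernel_le_of_smooth (i : X ⟶ M) [IsClosedImmersion i] (i₀ : X ⟶ M₀) [IsAffineHom i₀]
    {k : Type u} [Field k] {t : M ⟶ Spec (.of k)} {t₀ : M₀ ⟶ Spec (.of k)}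
    [LocallyOfFiniteType t] [Smooth t₀] (h : i₀ ≫ t₀ = i ≫ t) (V₀ : M₀.AffineZariskiSite)
    (V : M.AffineZariskiSite) {W : X.AffineZariskiSite} (hV₀ : W ≤ preim i₀ V₀)
    (hV : W ≤ preim i V) : extKernel y i₀ V₀ hV₀ ≤ extKernel y i V hV := by
  have hs (V : M.AffineZariskiSite) : Function.Surjective (sectionMap i V) :=
    i.app_surjective V.1 V.2
  obtain ⟨f, hf⟩ := id hV
  obtain ⟨f, rfl⟩ := hs V f
  obtain rfl : preim i (V.basicOpen f) = W :=
    Subtype.ext ((Scheme.preimage_basicOpen i f).trans hf)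
  rw [extKernel_eq_map, extKernel_eq_map]
  have : IsLocallyNoetherian M := LocallyOfFiniteType.isLocallyNoetherian t
  have : IsNoetherianRing Γ(M, (V.basicOpen f).1) :=
    IsLocallyNoetherian.component_noetherian ⟨_, (V.basicOpen f).2⟩
  let := (t₀.appLE ⊤ V₀.1 le_top).hom.toAlgebra
  let := (t.appLE ⊤ (V.basicOpen f).1 le_top).hom.toAlgebra
  have : Algebra.FormallySmooth Γ(Spec (.of k), ⊤) Γ(M₀, V₀.1) :=
    (t₀.smooth_appLE (isAffineOpen_top _) V₀.2 le_top).formallySmooth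
  have hk : ((resO hV₀).comp (sectionMap i₀ V₀)).comp (algebraMap Γ(Spec (.of k), ⊤) Γ(M₀, V₀.1)) =
      (sectionMap i (V.basicOpen f)).comp
        (algebraMap Γ(Spec (.of k), ⊤) Γ(M, (V.basicOpen f).1)) := by
    refine (resO_sectionMap_appLE i₀ h V₀ hV₀).trans
      ((resO_sectionMap_appLE i rfl (V.basicOpen f) le_rfl).symm.trans ?_)
    refine RingHom.ext fun r => ?_
    exact resO_self _ _
  -- The ideal of `Y` in `M` is the whole preimage of the ideal of `Y` in `X`; in particular it
  -- contains the kernel of the quotient map, to which Artin–Rees is applied.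
  have hJ : (idealOf y.ker (preim i (V.basicOpen f))).comap (sectionMap i (V.basicOpen f)) ≤
      idealOf (y ≫ i).ker (V.basicOpen f) := by
    intro x hz
    simp only [idealOf, Scheme.Hom.ker_apply, RingHom.mem_ker, Ideal.mem_comap] at hz ⊢
    rw [Scheme.Hom.comp_app]
    exact hz
  refine (map_relIdeal_le_of_formallySmooth _ _ hk (hs _) _
    (ideal_le_comap_sectionMap y i (V.basicOpen f)) hJ).trans ?_
  refine (Ideal.map_mono (relIdeal_le_map_of_isAwayMap
    (ideal_le_comap (y ≫ i).ker (V.basicOpen_le f)) (GradedAlg.isAwayMap_resO V f)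
    (map_idealOf _ V f))).trans ?_
  have e : (sectionMap i (V.basicOpen f)).comp (resO (V.basicOpen_le f)) =
      (resO hV).comp (sectionMap i V) :=
    RingHom.ext fun r => sectionMap_resO i (V.basicOpen_le f) r
  exact (map_symMap_map_symMap _ _ e (ideal_le_comap (y ≫ i).ker (V.basicOpen_le f))
    (ideal_le_comap_sectionMap y i (V.basicOpen f))
    (ideal_le_comap_resO_sectionMap y i V hV) _).le

/-- Membership in `qSymKer` is a condition on all pairs `V`, `W`. By `extKernel_le_of_smooth` it can
be tested near each point on a single chart of a smooth `M₀`. Taking `M = M₀` gives independence of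
the chart. -/
lemma mem_qSymKer_of_locally_mem (i : X ⟶ M) [IsClosedImmersion i] (i₀ : X ⟶ M₀) [IsAffineHom i₀]
    {k : Type u} [Field k] {t : M ⟶ Spec (.of k)} {t₀ : M₀ ⟶ Spec (.of k)}
    [LocallyOfFiniteType t] [Smooth t₀] (h : i₀ ≫ t₀ = i ≫ t) {U : X.AffineZariskiSite}
    {a : (symAlg y.ker).obj U} (H : ∀ x ∈ U.1, ∃ (V₀ : M₀.AffineZariskiSite)
      (W : X.AffineZariskiSite) (hU : W ≤ U) (hV₀ : W ≤ preim i₀ V₀), x ∈ W.1 ∧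
        (symAlg y.ker).res hU a ∈ extKernel y i₀ V₀ hV₀) : a ∈ (qSymKer y i).ideal U := by
  refine (mem_qSymKer y i).mpr fun V W hU hV => (symAlg y.ker).mem_of_locally_mem _ _ fun x hx => ?_
  obtain ⟨V₀, W₀, hU₀, hV₀, hx₀, ha⟩ := H x (toOpens_mono hU hx)
  obtain ⟨W', h₁, h₂, hx'⟩ := exists_common_basicOpen W W₀ hx hx₀
  refine ⟨W', h₁, hx', ?_⟩
  rw [(symAlg y.ker).res_res_apply, map_res_extKernel,
    ← (symAlg y.ker).res_res_apply h₂ hU₀]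
  refine extKernel_le_of_smooth y i i₀ h V₀ V (h₂.trans hV₀) _ ?_
  rw [← map_res_extKernel y i₀ V₀ h₂ hV₀]
  exact Ideal.mem_map_of_mem ((symAlg y.ker).res h₂).toRingHom ha

lemma exists_preim_le (i₀ : X ⟶ M₀) [IsAffineHom i₀] (U : X.AffineZariskiSite) {x : X}
    (hx : x ∈ U.1) : ∃ (V₀ : M₀.AffineZariskiSite) (W : X.AffineZariskiSite),
      W ≤ U ∧ W ≤ preim i₀ V₀ ∧ x ∈ W.1 := by
  obtain ⟨V₀, hV₀⟩ := exists_affineZariskiSite_mem (i₀ x)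
  exact ⟨V₀, exists_common_basicOpen U (preim i₀ V₀) hx hV₀⟩

/-- The kernel for a smooth ambient scheme is contained in the kernel for any other one. -/
theorem qSymKer_le_of_smooth (i : X ⟶ M) [IsClosedImmersion i] (i₀ : X ⟶ M₀) [IsAffineHom i₀]
    {k : Type u} [Field k] {t : M ⟶ Spec (.of k)} {t₀ : M₀ ⟶ Spec (.of k)}
    [LocallyOfFiniteType t] [Smooth t₀] (h : i₀ ≫ t₀ = i ≫ t) (U : X.AffineZariskiSite) :
    (qSymKer y i₀).ideal U ≤ (qSymKer y i).ideal U := by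
  refine fun a ha => mem_qSymKer_of_locally_mem y i i₀ h fun x hx => ?_
  obtain ⟨V₀, W, hU, hV, hxW⟩ := exists_preim_le i₀ U hx
  exact ⟨V₀, W, hU, hV, hxW, ha V₀ W hU hV⟩

lemma qSymKer_preim_le (i : X ⟶ M) [IsAffineHom i] (V : M.AffineZariskiSite) :
    (qSymKer y i).ideal (preim i V) ≤
      qSymKernel (sectionMap i V) (ideal_le_comap_sectionMap y i V) := by
  intro a ha
  have := (mem_qSymKer y i).mp ha V _ le_rfl le_rfl
  rwa [(symAlg y.ker).res_self, extKernel_self] at this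

/-- With `qSymKer_preim_le`, this identifies the sheaf-theoretic kernel over a preimage with the
kernel computed on that one chart. This direction uses smoothness, to pass to other charts. -/
lemma qSymKernel_le_qSymKer_preim (i : X ⟶ M) [IsClosedImmersion i] {k : Type u} [Field k]
    {t : M ⟶ Spec (.of k)} [Smooth t] (V : M.AffineZariskiSite) :
    qSymKernel (sectionMap i V) (ideal_le_comap_sectionMap y i V) ≤
      (qSymKer y i).ideal (preim i V) := by
  refine fun a ha => mem_qSymKer_of_locally_mem y i i (t := t) (t₀ := t) rfl fun x hx => ?_
  refine ⟨V, _, le_rfl, le_rfl, hx, ?_⟩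
  rw [(symAlg y.ker).res_self, extKernel_self]
  exact ha

/-- The kernel of the surjection to the quasi-symmetric algebra of a smooth ambient scheme is
quasi-coherent. -/
theorem exists_pow_mul_mem_qSymKer (i : X ⟶ M) [IsClosedImmersion i] {k : Type u} [Field k]
    {t : M ⟶ Spec (.of k)} [Smooth t] (U : X.AffineZariskiSite) (f : Γ(X, U.1))
    {a : (symAlg y.ker).obj U}
    (ha : (symAlg y.ker).res (U.basicOpen_le f) a ∈ (qSymKer y i).ideal (U.basicOpen f)) :
    ∃ n : ℕ, algebraMap _ ((symAlg y.ker).obj U) f ^ n * a ∈ (qSymKer y i).ideal U := by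
  let F := algebraMap _ ((symAlg y.ker).obj U) f
  -- Over `D(g)` with `g ∈ T`, a single chart and a single power of `f` suffice. Such `D(g)` cover
  -- `U`, and finitely many of them give a uniform power.
  let T : Set Γ(X, U.1) := {g | ∃ (V : M.AffineZariskiSite) (hV : U.basicOpen g ≤ preim i V)
    (n : ℕ), (symAlg y.ker).res (U.basicOpen_le g) (F ^ n * a) ∈ extKernel y i V hV}
  have hT : U.1 ≤ ⨆ g : T, X.basicOpen (g : Γ(X, U.1)) := by
    intro x hx
    obtain ⟨V, W, hU, hV, hxW⟩ := exists_preim_le i U hx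
    obtain ⟨g, hg⟩ := id hU
    obtain rfl : U.basicOpen g = W := Subtype.ext hg
    refine TopologicalSpace.Opens.mem_iSup.mpr ⟨⟨g, V, hV, ?_⟩, hxW⟩
    let f' : Γ(X, (U.basicOpen g).1) := resO hU f
    -- This is `D(f) ∩ D(g)`, where the hypothesis on `a` applies; descending from it to `D(g)`
    -- costs a power of `f`.
    let W' := (U.basicOpen g).basicOpen f'
    have hW'f : W' ≤ U.basicOpen f := by
      refine ⟨resO (U.basicOpen_le f) g, ?_⟩
      refine (Scheme.basicOpen_res X g _).trans (Eq.trans ?_ (Scheme.basicOpen_res X f _).symm)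
      exact inf_comm _ _
    have h1 := (mem_qSymKer y i).mp ha V W' hW'f (((U.basicOpen g).basicOpen_le f').trans hV)
    rw [(symAlg y.ker).res_res_apply,
      ← (symAlg y.ker).res_res_apply ((U.basicOpen g).basicOpen_le f') hU,
      ← map_res_extKernel y i V ((U.basicOpen g).basicOpen_le f') hV] at h1
    obtain ⟨n, hn⟩ := ((symAlg y.ker).isAwayMap_res _ f' rfl).exists_pow_mul_mem h1
    refine ⟨n, ?_⟩
    rw [map_mul, map_pow, (symAlg y.ker).res_algebraMap]
    exact hn
  rw [U.2.self_le_iSup_basicOpen_iff, Ideal.span_eq_top_iff_finite] at hT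
  obtain ⟨T', hT', hspan⟩ := hT
  have hN : ∃ N : ℕ, ∀ g ∈ T', ∃ (V : M.AffineZariskiSite) (hV : U.basicOpen g ≤ preim i V),
      (symAlg y.ker).res (U.basicOpen_le g) (F ^ N * a) ∈ extKernel y i V hV := by
    choose V hV n hn using hT'
    refine ⟨T'.attach.sup fun g => n g.2, fun g hg => ⟨V hg, hV hg, ?_⟩⟩
    obtain ⟨c, hc⟩ := Nat.exists_eq_add_of_le
      (Finset.le_sup (f := fun g : T' => n g.2) (T'.mem_attach ⟨g, hg⟩))
    rw [hc, add_comm, pow_add, mul_assoc, map_mul]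
    exact Ideal.mul_mem_left _ _ (hn hg)
  obtain ⟨N, hN⟩ := hN
  refine ⟨N, mem_qSymKer_of_locally_mem y i i (t := t) (t₀ := t) rfl fun x hx => ?_⟩
  rw [← U.2.self_le_iSup_basicOpen_iff] at hspan
  obtain ⟨⟨g, hg⟩, hxg⟩ := TopologicalSpace.Opens.mem_iSup.mp (hspan hx)
  obtain ⟨V, hV, hm⟩ := hN g hg
  exact ⟨V, _, U.basicOpen_le g, hV, hxg, hm⟩

end ExtendedKernel
-- Inverse limits of quotients by a family of ideals with a least member.
namespace GradedAlg
section LeastIdeal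
variable {X : Scheme.{u}} {𝒮 : GradedAlg X} (𝒦 : Set 𝒮.IdealFamily)

lemma toLimQuot_algebraMap (U : X.AffineZariskiSite) (r : Γ(X, U.1)) :
    toLimQuot 𝒦 U (algebraMap _ (𝒮.obj U) r) = algebraMap _ ((limQuot 𝒦).obj U) r := by
  refine (toLimQuot_of_mem 𝒦 (algebraMap_mem_zero (𝒮.gr U) r)).trans ?_
  refine Eq.trans ?_ (DirectSum.algebraMap_apply ..).symm
  rfl

lemma res_toLimQuot {U V : X.AffineZariskiSite} (h : U ≤ V) (a : 𝒮.obj V) :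
    (limQuot 𝒦).res h (toLimQuot 𝒦 V a) = toLimQuot 𝒦 U (𝒮.res h a) :=
  congr($(toLimQuot_res 𝒦 h) a).symm

variable {𝒦} {K₀ : 𝒮.IdealFamily} (hK₀ : K₀ ∈ 𝒦)
  (hle : ∀ K ∈ 𝒦, ∀ U, K₀.ideal U ≤ K.ideal U)
include hK₀ hle

/-- Every quotient in the system is a quotient of the one by `K₀`, so a compatible family is
determined by its component at `K₀`, and any lift of that component lifts the family. -/
lemma toLimQuot_surjective (U : X.AffineZariskiSite) : Function.Surjective (toLimQuot 𝒦 U) := by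
  intro z
  change ⨁ d, limPart 𝒦 U d at z
  induction z using DirectSum.induction_on with
  | zero => exact ⟨0, map_zero _⟩
  | of d x =>
    obtain ⟨x, hx, hx'⟩ := x
    obtain ⟨a, ha, e⟩ := hx ⟨K₀, hK₀⟩
    refine ⟨a, (toLimQuot_of_mem 𝒦 ha).trans ?_⟩
    congr 1
    ext1
    funext K
    change Ideal.Quotient.mk _ a = x K
    rw [← hx' ⟨K₀, hK₀⟩ K (hle K.1 K.2), ← e]
    rfl
  | add x y hx hy =>
    obtain ⟨a, rfl⟩ := hx
    obtain ⟨b, rfl⟩ := hy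
    exact ⟨a + b, map_add _ _ _⟩

/-- Restricted to homogeneous `a` because the limit is formed degree by degree and `K₀` is not
assumed homogeneous; for general `a` the criterion concerns each component. -/
lemma toLimQuot_eq_zero_iff {U : X.AffineZariskiSite} {d : ℕ} {a : 𝒮.obj U}
    (ha : a ∈ 𝒮.gr U d) : toLimQuot 𝒦 U a = 0 ↔ a ∈ K₀.ideal U := by
  have h0 := toLimQuot_of_mem 𝒦 ha
  constructor
  · intro h
    have h1 := DirectSum.of_injective (β := fun d => limPart 𝒦 U d) d
      ((h0.symm.trans h).trans (map_zero _).symm)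
    exact Ideal.Quotient.eq_zero_iff_mem.mp congr($(congr(Subtype.val $h1)) ⟨K₀, hK₀⟩)
  · intro h
    refine h0.trans (Eq.trans ?_ (map_zero (DirectSum.of (fun d => limPart 𝒦 U d) d)))
    congr 1
    ext1
    funext K
    exact Ideal.Quotient.eq_zero_iff_mem.mpr (hle K.1 K.2 U h)

lemma toLimQuot_eq_zero_of_decompose {U : X.AffineZariskiSite} {a : 𝒮.obj U}
    (h : ∀ d, (DirectSum.decompose (𝒮.gr U) a d : 𝒮.obj U) ∈ K₀.ideal U) :
    toLimQuot 𝒦 U a = 0 := by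
  classical
  rw [← DirectSum.sum_support_decompose (𝒮.gr U) a, map_sum]
  exact Finset.sum_eq_zero fun d _ =>
    (toLimQuot_eq_zero_iff hK₀ hle (Subtype.prop _)).mpr (h d)

lemma decompose_mem_of_toLimQuot_eq_zero {U : X.AffineZariskiSite} {a : 𝒮.obj U}
    (h : toLimQuot 𝒦 U a = 0) (d : ℕ) :
    (DirectSum.decompose (𝒮.gr U) a d : 𝒮.obj U) ∈ K₀.ideal U := by
  rw [← toLimQuot_eq_zero_iff hK₀ hle (Subtype.prop _), GradedRingHom.map_directSumDecompose, h]
  simp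

/-- Units and denominators pass from `𝒮` to the quotient by surjectivity. For the kernel, `hqc`
supplies one power of `f` for each homogeneous component, and the largest of these finitely many
exponents serves for all. -/
lemma limQuot_isQuasiCoherent [𝒮.IsQuasiCoherent]
    (hqc : ∀ (U : X.AffineZariskiSite) (f : Γ(X, U.1)) (a : 𝒮.obj U),
      𝒮.res (U.basicOpen_le f) a ∈ K₀.ideal (U.basicOpen f) →
        ∃ n : ℕ, algebraMap _ (𝒮.obj U) f ^ n * a ∈ K₀.ideal U) :
    (limQuot 𝒦).IsQuasiCoherent where
  isAwayMap U f := by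
    have hs := isAwayMap_iff.mp (IsQuasiCoherent.isAwayMap (𝒜 := 𝒮) U f)
    have e1 (a : 𝒮.obj U) := res_toLimQuot 𝒦 (U.basicOpen_le f) a
    rw [← toLimQuot_algebraMap]
    refine isAwayMap_iff.mpr ⟨?_, fun z => ?_, fun x hx => ?_⟩
    · change IsUnit ((limQuot 𝒦).res _ _)
      rw [e1]
      exact hs.1.map (toLimQuot 𝒦 (U.basicOpen f)).toRingHom
    · obtain ⟨b, rfl⟩ := toLimQuot_surjective hK₀ hle _ z
      obtain ⟨x, n, hx⟩ := hs.2.1 b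
      refine ⟨toLimQuot 𝒦 U x, n, ?_⟩
      change _ * ((limQuot 𝒦).res _ _) ^ n = (limQuot 𝒦).res _ _
      rw [e1, e1, ← map_pow, ← map_mul]
      exact congrArg _ hx
    · obtain ⟨a, rfl⟩ := toLimQuot_surjective hK₀ hle _ x
      change (limQuot 𝒦).res _ _ = 0 at hx
      rw [e1] at hx
      have hd (d : ℕ) : ∃ n : ℕ, algebraMap _ (𝒮.obj U) f ^ n *
          (DirectSum.decompose (𝒮.gr U) a d : 𝒮.obj U) ∈ K₀.ideal U := by
        refine hqc U f _ ?_
        rw [GradedRingHom.map_directSumDecompose]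
        exact decompose_mem_of_toLimQuot_eq_zero hK₀ hle hx d
      choose n hn using hd
      classical
      refine ⟨(DirectSum.decompose (𝒮.gr U) a).support.sup n, ?_⟩
      rw [← map_pow, ← map_mul]
      nth_rw 2 [← DirectSum.sum_support_decompose (𝒮.gr U) a]
      rw [Finset.mul_sum, map_sum]
      refine Finset.sum_eq_zero fun d hd => ?_
      obtain ⟨c, hc⟩ := Nat.exists_eq_add_of_le (Finset.le_sup (f := n) hd)
      rw [hc, add_comm, pow_add, mul_assoc, map_mul]
      refine mul_eq_zero_of_right _ ((toLimQuot_eq_zero_iff hK₀ hle (d := d) ?_).mpr (hn d))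
      rw [← map_pow, ← Algebra.smul_def]
      exact Submodule.smul_mem _ _ (Subtype.prop _)

end LeastIdeal
end GradedAlg

/-! ### The quasi-symmetric algebra computed by one smooth embedding. -/

section SmoothEmbedding
variable {k : Type u} [Field k] {X Y M : Scheme.{u}} (s : X ⟶ Spec (.of k)) (y : Y ⟶ X)
  [QuasiCompact y] {t : M ⟶ Spec (.of k)} {i : X ⟶ M} [Smooth t] [QuasiCompact t]
  [IsClosedImmersion i] (h : i ≫ t = s)
include h

lemma qSymKer_mem_embeddingKernels : qSymKer y i ∈ embeddingKernels s y :=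
  ⟨M, t, i, inferInstance, inferInstance, inferInstance, h, rfl⟩

omit [QuasiCompact t] in
lemma qSymKer_le_of_mem_embeddingKernels (K) (hK : K ∈ embeddingKernels s y)
    (U : X.AffineZariskiSite) : (qSymKer y i).ideal U ≤ K.ideal U := by
  obtain ⟨M', t', i', _, _, _, h', rfl⟩ := hK
  exact qSymKer_le_of_smooth y i' i (h.trans h'.symm) U

lemma symToQSym_surjective (U : X.AffineZariskiSite) : Function.Surjective (symToQSym s y U) :=
  GradedAlg.toLimQuot_surjective (qSymKer_mem_embeddingKernels s y h)
    (qSymKer_le_of_mem_embeddingKernels s y h) U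

lemma symToQSym_eq_zero_iff {U : X.AffineZariskiSite} {d : ℕ} {a : (symAlg y.ker).obj U}
    (ha : a ∈ (symAlg y.ker).gr U d) : symToQSym s y U a = 0 ↔ a ∈ (qSymKer y i).ideal U :=
  GradedAlg.toLimQuot_eq_zero_iff (qSymKer_mem_embeddingKernels s y h)
    (qSymKer_le_of_mem_embeddingKernels s y h) ha

theorem qSymAlg_isQuasiCoherent : (qSymAlg s y).IsQuasiCoherent :=
  GradedAlg.limQuot_isQuasiCoherent (qSymKer_mem_embeddingKernels s y h)
    (qSymKer_le_of_mem_embeddingKernels s y h)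
    fun U f _ ha => exists_pow_mul_mem_qSymKer y i (t := t) U f ha

end SmoothEmbedding
-- Factorization of morphisms through the Proj of a quotient.
section ProjFactorization
open Limits HomogeneousLocalization HomogeneousIdeal

/-- Factorizations through a monomorphism are unique, so the local ones agree on overlaps and glue.
-/
lemma exists_factorization_of_openCover {Z Q S : Scheme.{u}} (j : Q ⟶ S) [Mono j] (ι : Z ⟶ S)
    (𝒰 : Z.OpenCover) (g : ∀ x, 𝒰.X x ⟶ Q) (hg : ∀ x, g x ≫ j = 𝒰.f x ≫ ι) :
    ∃ g : Z ⟶ Q, g ≫ j = ι := by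
  have h (x y) : pullback.fst (𝒰.f x) (𝒰.f y) ≫ g x = pullback.snd _ _ ≫ g y := by
    rw [← cancel_mono j, Category.assoc, Category.assoc, hg, hg]
    exact pullback.condition_assoc _
  refine ⟨Scheme.Cover.glueMorphisms 𝒰 g h, Scheme.Cover.hom_ext 𝒰 _ _ fun x => ?_⟩
  rw [Scheme.Cover.ι_glueMorphisms_assoc]
  exact hg x

lemma exists_factorization_of_local {Z Q S : Scheme.{u}} (j : Q ⟶ S) [Mono j] (ι : Z ⟶ S)
    (H : ∀ z : Z, ∃ (T : Scheme.{u}) (a : T ⟶ Z) (_ : IsOpenImmersion a) (g : T ⟶ Q),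
      z ∈ Set.range a ∧ g ≫ j = a ≫ ι) : ∃ g : Z ⟶ Q, g ≫ j = ι := by
  choose T a ha g hz hg using H
  exact exists_factorization_of_openCover j ι
    (Scheme.Cover.mkOfCovers Z T a (fun z => ⟨z, hz z⟩) ha) g hg

lemma isZariskiLocalAtTarget_of_isPullback {P : MorphismProperty Scheme.{u}}
    [IsZariskiLocalAtTarget P] {X Z : Scheme.{u}} {f : X ⟶ Z} (𝒰 : Z.OpenCover)
    {V : 𝒰.I₀ → Scheme.{u}} {p : ∀ i, V i ⟶ 𝒰.X i} {q : ∀ i, V i ⟶ X}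
    (h : ∀ i, IsPullback (p i) (q i) (𝒰.f i) f) (H : ∀ i, P (p i)) : P f := by
  refine IsZariskiLocalAtTarget.of_openCover 𝒰 fun i => ?_
  refine (MorphismProperty.cancel_left_of_respectsIso P (h i).flip.isoPullback.hom
    (𝒰.pullbackHom f i)).mp ?_
  have : (h i).flip.isoPullback.hom ≫ 𝒰.pullbackHom f i = p i :=
    (h i).flip.isoPullback_hom_snd
  exact Eq.mpr (congrArg (fun q : V i ⟶ 𝒰.X i => P q) this) (H i)

lemma surjective_homogeneous {R S A B : Type*} [CommRing R] [CommRing S] [CommRing A] [CommRing B]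
    [Algebra R A] [Algebra S B] {𝒜 : ℕ → Submodule R A} {ℬ : ℕ → Submodule S B}
    [GradedAlgebra 𝒜] [GradedAlgebra ℬ] (ψ : 𝒜 →+*ᵍ ℬ) (h : Function.Surjective ψ) {d : ℕ} {b : B}
    (hb : b ∈ ℬ d) : ∃ a ∈ 𝒜 d, ψ a = b := by
  obtain ⟨a, rfl⟩ := h b
  refine ⟨DirectSum.decompose 𝒜 a d, Subtype.prop _, ?_⟩
  rw [GradedRingHom.map_directSumDecompose, DirectSum.decompose_of_mem_same ℬ hb]

lemma awayMap_surjective {R S A B : Type*} [CommRing R] [CommRing S] [CommRing A] [CommRing B]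
    [Algebra R A] [Algebra S B] {𝒜 : ℕ → Submodule R A} {ℬ : ℕ → Submodule S B}
    [GradedAlgebra 𝒜] [GradedAlgebra ℬ] (ψ : 𝒜 →+*ᵍ ℬ) (h : Function.Surjective ψ) {d : ℕ} {s : A}
    (hs : s ∈ 𝒜 d) : Function.Surjective (Away.map ψ s) := by
  intro z
  obtain ⟨n, b, hb, rfl⟩ := Away.mk_surjective ℬ (ψ.2 hs) z
  obtain ⟨a, ha, rfl⟩ := surjective_homogeneous ψ h hb
  exact ⟨.mk 𝒜 hs n a ha, Away.map_mk ψ s hs n a ha⟩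

variable {R₁ R₂ R₃ R₄ A₁ A₂ A₃ A₄ : Type u} [CommRing R₁] [CommRing R₂] [CommRing R₃] [CommRing R₄]
  [CommRing A₁] [CommRing A₂] [CommRing A₃] [CommRing A₄] [Algebra R₁ A₁] [Algebra R₂ A₂]
  [Algebra R₃ A₃] [Algebra R₄ A₄] {𝒜 : ℕ → Submodule R₁ A₁} {𝒮 : ℕ → Submodule R₂ A₂}
  {ℛ : ℕ → Submodule R₃ A₃} {𝒬 : ℕ → Submodule R₄ A₄} [GradedAlgebra 𝒜] [GradedAlgebra 𝒮]
  [GradedAlgebra ℛ] [GradedAlgebra 𝒬]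

lemma isClosedImmersion_projMap (ψ : 𝒜 →+*ᵍ 𝒮) (hψ : Function.Surjective ψ)
    (h : irrelevant 𝒮 ≤ (irrelevant 𝒜).map ψ) : IsClosedImmersion (Proj.map ψ h) :=
  isZariskiLocalAtTarget_of_isPullback (P := @IsClosedImmersion)
    (Proj.affineOpenCover 𝒜).openCover
    (p := fun s => Spec.map (CommRingCat.ofHom (Away.map ψ (s.2 : A₁))))
    (fun s => isPullback_awayι ψ h s.2.2 s.1.2)
    fun s => IsClosedImmersion.spec_of_surjective _ (awayMap_surjective ψ hψ s.2.2)

lemma awayι_projMap_projToSpec (ψ : 𝒜 →+*ᵍ 𝒮) (h : irrelevant 𝒮 ≤ (irrelevant 𝒜).map ψ)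
    (φ : R₁ →+* R₂) (hφ : ∀ r, ψ (algebraMap R₁ A₁ r) = algebraMap R₂ A₂ (φ r)) {d : ℕ} {s : A₁}
    (hs : s ∈ 𝒜 d) (hd : 0 < d) :
    Proj.awayι 𝒮 (ψ s) (ψ.2 hs) hd ≫ Proj.map ψ h ≫ projToSpec 𝒜 =
      Proj.awayι 𝒮 (ψ s) (ψ.2 hs) hd ≫ projToSpec 𝒮 ≫ Spec.map (CommRingCat.ofHom φ) := by
  have hψs : ψ s ∈ 𝒮 d := ψ.2 hs
  have h1 := awayι_projToSpec hψs hd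
  have h2 := Proj.awayι_comp_map ψ h hd s hs
  rw [← Category.assoc, h2, Category.assoc, awayι_projToSpec hs hd, ← Category.assoc, h1,
    ← Spec.map_comp, ← Spec.map_comp]
  congr 1
  ext r
  exact congrArg HomogeneousLocalization.val (awayMap_fromZero ψ s r (φ r) (hφ r))

lemma projMap_projToSpec (ψ : 𝒜 →+*ᵍ 𝒮) (h : irrelevant 𝒮 ≤ (irrelevant 𝒜).map ψ) (φ : R₁ →+* R₂)
    (hφ : ∀ r, ψ (algebraMap R₁ A₁ r) = algebraMap R₂ A₂ (φ r)) :
    Proj.map ψ h ≫ projToSpec 𝒜 = projToSpec 𝒮 ≫ Spec.map (CommRingCat.ofHom φ) :=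
  (Proj.mapAffineOpenCover ψ h).openCover.hom_ext _ _ fun s =>
    awayι_projMap_projToSpec ψ h φ hφ s.2.2 s.1.2

/-- If a fraction with numerator `a` dies in `𝒬`, then `χ` kills `a` times a power of `ψ s`. By `H`
this product lifts to some `b` with `ρ b = 0`. The fraction then comes from `𝒜`, and its value can
be computed through `ℛ`, where it is zero. -/
lemma awayMap_eq_zero_imp (ψ : 𝒜 →+*ᵍ 𝒮) (ρ : 𝒜 →+*ᵍ ℛ) (χ : 𝒮 →+*ᵍ 𝒬)
    (H : ∀ d, ∀ a ∈ 𝒮 d, χ a = 0 → ∃ b ∈ 𝒜 d, ψ b = a ∧ ρ b = 0) {C : Type*} [CommRing C]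
    {d : ℕ} {s : A₁} (hs : s ∈ 𝒜 d) (L : Away 𝒮 (ψ s) →+* C) (N : Away ℛ (ρ s) →+* C)
    (hLN : L.comp (Away.map ψ s) = N.comp (Away.map ρ s)) {x : Away 𝒮 (ψ s)}
    (hx : Away.map χ (ψ s) x = 0) : L x = 0 := by
  obtain ⟨n, a, ha, rfl⟩ := Away.mk_surjective 𝒮 (ψ.2 hs) x
  rw [Away.map_mk] at hx
  have hx2 := congr(HomogeneousLocalization.val $hx)
  rw [Away.val_mk, HomogeneousLocalization.val_zero, Localization.mk_eq_mk',
    IsLocalization.mk'_eq_zero_iff] at hx2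
  obtain ⟨⟨_, k, rfl⟩, hk⟩ := hx2
  have hk' : χ ((ψ s) ^ k * a) = 0 := by rw [map_mul, map_pow]; exact hk
  have hm : (ψ s) ^ k * a ∈ 𝒮 ((k + n) • d) := by
    rw [add_smul]
    exact SetLike.mul_mem_graded (SetLike.pow_mem_graded k (ψ.2 hs)) ha
  obtain ⟨b, hb, hba, hb0⟩ := H _ _ hm hk'
  have h1 : Away.mk 𝒮 (ψ.2 hs) n a ha = Away.map ψ s (.mk 𝒜 hs (k + n) b hb) := by
    rw [Away.map_mk]
    ext
    rw [Away.val_mk, Away.val_mk, Localization.mk_eq_mk_iff, Localization.r_iff_exists]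
    refine ⟨1, ?_⟩
    simp only [hba, OneMemClass.coe_one, one_mul, pow_add]
    exact (mul_right_comm (ψ s ^ k) (ψ s ^ n) a).trans (mul_comm _ _)
  rw [h1, ← RingHom.comp_apply, hLN, RingHom.comp_apply, Away.map_mk]
  have h2 : Away.mk ℛ (ρ.2 hs) (k + n) (ρ b) (ρ.2 hb) = 0 := by
    ext
    rw [Away.val_mk, HomogeneousLocalization.val_zero]
    simp only [hb0, Localization.mk_zero]
  exact (congrArg N h2).trans (map_zero N)

/-- Near `z` everything is affine: `f` and `e` become the ring maps `L` and `N`, and `L` kills the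
kernel of the surjection onto the degree zero fractions of `𝒬` by `awayMap_eq_zero_imp`. -/
lemma exists_local_factorization_projMap (ψ : 𝒜 →+*ᵍ 𝒮) (ρ : 𝒜 →+*ᵍ ℛ) (χ : 𝒮 →+*ᵍ 𝒬)
    (hχ : Function.Surjective χ)
    (H : ∀ d, ∀ a ∈ 𝒮 d, χ a = 0 → ∃ b ∈ 𝒜 d, ψ b = a ∧ ρ b = 0)
    (hψ' : irrelevant 𝒮 ≤ (irrelevant 𝒜).map ψ) (hρ' : irrelevant ℛ ≤ (irrelevant 𝒜).map ρ)
    (hχ' : irrelevant 𝒬 ≤ (irrelevant 𝒮).map χ) {Z : Scheme.{u}} (f : Z ⟶ Proj 𝒮)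
    (e : Z ⟶ Proj ℛ) (hfe : f ≫ Proj.map ψ hψ' = e ≫ Proj.map ρ hρ') (z : Z) {d : ℕ} (hd : 0 < d)
    {s : A₁} (hs : s ∈ 𝒜 d) (hψs : ψ s ∈ 𝒮 d)
    (hz : f z ∈ Set.range (Proj.awayι 𝒮 (ψ s) hψs hd)) :
    ∃ (T : Scheme.{u}) (a : T ⟶ Z) (_ : IsOpenImmersion a) (g : T ⟶ Proj 𝒬),
      z ∈ Set.range a ∧ g ≫ Proj.map χ hχ' = a ≫ f := by
  have hχs : χ (ψ s) ∈ 𝒬 d := χ.2 hψs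
  obtain ⟨_, ⟨U, hU, rfl⟩, hzU, hUD⟩ := Z.isBasis_affineOpens.exists_subset_of_mem_open
    (show z ∈ f ⁻¹ᵁ (Proj.awayι 𝒮 (ψ s) hψs hd).opensRange from hz)
    (f ⁻¹ᵁ (Proj.awayι 𝒮 (ψ s) hψs hd).opensRange).isOpen
  replace hU : IsAffineOpen U := hU
  have hUZ : Set.range (hU.fromSpec ≫ f) ⊆ Set.range (Proj.awayι 𝒮 (ψ s) hψs hd) := by
    rintro _ ⟨x, rfl⟩
    have : hU.fromSpec x ∈ (U : Set Z) := hU.range_fromSpec ▸ Set.mem_range_self x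
    exact hUD this
  obtain ⟨l, hl⟩ : ∃ l, l ≫ Proj.awayι 𝒮 (ψ s) hψs hd = hU.fromSpec ≫ f :=
    ⟨_, IsOpenImmersion.lift_fac _ _ hUZ⟩
  have w : (l ≫ Spec.map (CommRingCat.ofHom (Away.map ψ s))) ≫ Proj.awayι 𝒜 s hs hd =
      (hU.fromSpec ≫ e) ≫ Proj.map ρ hρ' := by
    have h1 := Proj.awayι_comp_map ψ hψ' hd s hs
    rw [Category.assoc, Category.assoc, ← hfe, ← Category.assoc _ f, ← hl, Category.assoc, h1]
  -- Since `D₊(ρ s)` is the preimage of `D₊(s)`, the restriction of `e` to `U` automatically lands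
  -- in this chart of `Proj ℛ`.
  obtain ⟨m, hm⟩ : ∃ m, m ≫ Spec.map (CommRingCat.ofHom (Away.map ρ s)) =
      l ≫ Spec.map (CommRingCat.ofHom (Away.map ψ s)) :=
    ⟨_, (isPullback_awayι ρ hρ' hs hd).lift_fst _ _ w⟩
  obtain ⟨L, rfl⟩ := Spec.map_surjective l
  obtain ⟨N, rfl⟩ := Spec.map_surjective m
  rw [← Spec.map_comp, ← Spec.map_comp] at hm
  have hLN : L.hom.comp (Away.map ψ s) = N.hom.comp (Away.map ρ s) :=
    congr(($(Spec.map_injective hm)).hom).symm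
  have hker : RingHom.ker (Away.map χ (ψ s)) ≤ RingHom.ker L.hom := fun x hx =>
    awayMap_eq_zero_imp ψ ρ χ H hs L.hom N.hom hLN hx
  obtain ⟨κ, hκ⟩ : ∃ κ : Away 𝒬 (χ (ψ s)) →+* Γ(Z, U), κ.comp (Away.map χ (ψ s)) = L.hom :=
    ⟨_, RingHom.liftOfSurjective_comp _ (awayMap_surjective χ hχ hψs) ⟨L.hom, hker⟩⟩
  have hL : L = CommRingCat.ofHom (Away.map χ (ψ s)) ≫ CommRingCat.ofHom κ :=
    CommRingCat.hom_ext hκ.symm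
  refine ⟨_, hU.fromSpec, inferInstance,
    Spec.map (CommRingCat.ofHom κ) ≫ Proj.awayι 𝒬 (χ (ψ s)) hχs hd, ?_, ?_⟩
  · rw [hU.range_fromSpec]; exact hzU
  · have h1 := Proj.awayι_comp_map χ hχ' hd (ψ s) hψs
    rw [← hl, hL, Spec.map_comp, Category.assoc, Category.assoc, h1]

/-- If `𝒬` is a quotient of `𝒮` by relations that come from `𝒜` and hold in `ℛ`, then compatible
morphisms to `Proj 𝒮` and `Proj ℛ` over `Proj 𝒜` factor through `Proj 𝒬`. -/
theorem exists_factorization_projMap (ψ : 𝒜 →+*ᵍ 𝒮) (ρ : 𝒜 →+*ᵍ ℛ) (χ : 𝒮 →+*ᵍ 𝒬)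
    (hχ : Function.Surjective χ)
    (H : ∀ d, ∀ a ∈ 𝒮 d, χ a = 0 → ∃ b ∈ 𝒜 d, ψ b = a ∧ ρ b = 0)
    (hψ' : irrelevant 𝒮 ≤ (irrelevant 𝒜).map ψ) (hρ' : irrelevant ℛ ≤ (irrelevant 𝒜).map ρ)
    (hχ' : irrelevant 𝒬 ≤ (irrelevant 𝒮).map χ) {Z : Scheme.{u}} (f : Z ⟶ Proj 𝒮)
    (e : Z ⟶ Proj ℛ) (hfe : f ≫ Proj.map ψ hψ' = e ≫ Proj.map ρ hρ') :
    ∃ g : Z ⟶ Proj 𝒬, g ≫ Proj.map χ hχ' = f := by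
  have := isClosedImmersion_projMap χ hχ hχ'
  refine exists_factorization_of_local _ f fun z => ?_
  -- The charts of `Proj 𝒮` at elements coming from `𝒜` already cover it, by the condition on
  -- irrelevant ideals; only for these are there matching charts of `Proj ℛ`.
  obtain ⟨s, p, hp⟩ := (Proj.mapAffineOpenCover ψ hψ').openCover.exists_eq (f z)
  exact exists_local_factorization_projMap ψ ρ χ hχ H hψ' hρ' hχ' f e hfe z s.1.2 s.2.2
    (ψ.2 s.2.2) ⟨p, hp⟩

end ProjFactorization
-- Induced morphisms of relative Proj: projections, charts, closed immersions.
namespace GradedAlg.HomAlong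
open Limits HomogeneousIdeal
variable {X M : Scheme.{u}} {i : X ⟶ M} {𝒮 : GradedAlg X} {𝒯 : GradedAlg M}
  [𝒮.IsQuasiCoherent] [𝒯.IsQuasiCoherent] (Φ : HomAlong i 𝒮 𝒯)

omit [𝒮.IsQuasiCoherent] [𝒯.IsQuasiCoherent] in
lemma le_preimage (V : M.AffineZariskiSite) : (Φ.p V).1 ≤ i ⁻¹ᵁ V.1 := (Φ.p_eq V).le

/-- Compatibility of the maps `𝒯(V) → 𝒮(i⁻¹ V)` with the structure sheaves. -/
def IsAlgebraHom : Prop :=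
  ∀ (V : M.AffineZariskiSite) (r : Γ(M, V.1)), Φ.φ V (algebraMap _ (𝒯.obj V) r) =
    algebraMap _ (𝒮.obj (Φ.p V)) ((i.appLE V.1 (Φ.p V).1 (Φ.le_preimage V)).hom r)

omit [𝒯.IsQuasiCoherent] in
lemma hom_ext_coverOver {T : Scheme.{u}} {f g : 𝒮.relProj ⟶ T}
    (h : ∀ V : M.AffineZariskiSite, pullback.fst (𝒮.proj ≫ i) V.1.ι ≫ f =
      pullback.fst (𝒮.proj ≫ i) V.1.ι ≫ g) : f = g :=
  Scheme.Cover.hom_ext (coverOver i 𝒮) _ _ h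

variable {Φ} in
lemma map_proj (hΦ : Φ.IsAlgebraHom) : Φ.map ≫ 𝒯.proj = 𝒮.proj ≫ i := by
  refine hom_ext_coverOver (i := i) fun V => ?_
  rw [← Category.assoc, Φ.fst_map, mapOver, Category.assoc, Category.assoc, 𝒯.chart_proj,
    ← Φ.toChart_chart, Category.assoc, ← Category.assoc (𝒮.chart _), 𝒮.chart_proj,
    Category.assoc]
  congr 1
  have h1 := projMap_projToSpec (Φ.φ V) (Φ.irrelevant_le V)
    (i.appLE V.1 (Φ.p V).1 (Φ.le_preimage V)).hom (hΦ V)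
  have h2 := IsAffineOpen.SpecMap_appLE_fromSpec i V.2 (Φ.p V).2 (Φ.le_preimage V)
  rw [← h2, ← Category.assoc, h1, Category.assoc]
  rfl

-- Compatibility with the projections makes the preimage of a chart again a chart. Properties local
-- on the target can therefore be checked on the morphisms `Proj.map`.
variable {Φ} in
lemma isPullback_chart_map (hΦ : Φ.IsAlgebraHom) (V : M.AffineZariskiSite) :
    IsPullback (Proj.map (Φ.φ V) (Φ.irrelevant_le V)) (𝒮.chart (Φ.p V)) (𝒯.chart V) Φ.map := by
  refine IsOpenImmersion.isPullback _ _ _ _ (Φ.chart_map V) ?_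
  rw [opensRange_chart, opensRange_chart, ← Scheme.Hom.comp_preimage, map_proj hΦ,
    Scheme.Hom.comp_preimage, Φ.p_eq]

variable {Φ} in
lemma isClosedImmersion_map (hΦ : Φ.IsAlgebraHom) (hs : ∀ V, Function.Surjective (Φ.φ V)) :
    IsClosedImmersion Φ.map :=
  isZariskiLocalAtTarget_of_isPullback (P := @IsClosedImmersion) 𝒯.projGluingData.cover
    (fun V => isPullback_chart_map hΦ V)
    fun V : M.AffineZariskiSite => isClosedImmersion_projMap (Φ.φ V) (hs V) (Φ.irrelevant_le V)

variable {Φ} in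
omit [𝒯.IsQuasiCoherent] in
lemma hom_ext_chart {T : Scheme.{u}} {f g : 𝒮.relProj ⟶ T}
    (h : ∀ V, 𝒮.chart (Φ.p V) ≫ f = 𝒮.chart (Φ.p V) ≫ g) : f = g := by
  refine hom_ext_coverOver (i := i) fun V => ?_
  rw [← Φ.toChart_chart, Category.assoc, Category.assoc, h]

end GradedAlg.HomAlong

/-! ### Descent of graded maps along surjections. -/

section GradedDescent
variable {R₁ R₂ R₃ A₁ A₂ A₃ : Type*} [CommRing R₁] [CommRing R₂] [CommRing R₃]
  [CommRing A₁] [CommRing A₂] [CommRing A₃] [Algebra R₁ A₁] [Algebra R₂ A₂]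
  [Algebra R₃ A₃] {𝒜 : ℕ → Submodule R₁ A₁} {ℬ : ℕ → Submodule R₂ A₂}
  {𝒞 : ℕ → Submodule R₃ A₃} [GradedAlgebra 𝒜] [GradedAlgebra ℬ]
  (π : 𝒜 →+*ᵍ ℬ) (hπ : Function.Surjective π) (g : 𝒜 →+*ᵍ 𝒞) (hg : ∀ a, π a = 0 → g a = 0)

/-- Descent of a map of graded rings along a surjection. -/
def gradedDesc : ℬ →+*ᵍ 𝒞 where
  toRingHom := π.toRingHom.liftOfSurjective hπ ⟨g.toRingHom, fun a ha => hg a ha⟩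
  map_mem {d b} hb := by
    obtain ⟨a, ha, rfl⟩ := surjective_homogeneous π hπ hb
    exact Set.mem_of_eq_of_mem (RingHom.liftOfSurjective_comp_apply π.toRingHom hπ
      ⟨g.toRingHom, fun a ha => hg a ha⟩ a) (g.map_mem ha)

lemma gradedDesc_apply (a : A₁) : gradedDesc π hπ g hg (π a) = g a :=
  RingHom.liftOfSurjective_comp_apply π.toRingHom hπ ⟨g.toRingHom, fun a ha => hg a ha⟩ a

end GradedDescent

lemma projMap_congr {R S A B : Type u} [CommRing R] [CommRing S] [CommRing A] [CommRing B]
    [Algebra R A] [Algebra S B] {𝒜 : ℕ → Submodule R A} {ℬ : ℕ → Submodule S B}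
    [GradedAlgebra 𝒜] [GradedAlgebra ℬ] {f g : 𝒜 →+*ᵍ ℬ} (h : f = g)
    (hf : HomogeneousIdeal.irrelevant ℬ ≤ (HomogeneousIdeal.irrelevant 𝒜).map f)
    (hg : HomogeneousIdeal.irrelevant ℬ ≤ (HomogeneousIdeal.irrelevant 𝒜).map g) :
    Proj.map f hf = Proj.map g hg := by
  subst h; rfl

lemma comp_eq_comp_of_squares {C : Type*} [Category C] {P Q Q' R A B B' D : C} {a : P ⟶ A}
    {f : A ⟶ B} {g : B ⟶ D} {f' : A ⟶ B'} {g' : B' ⟶ D} {p : P ⟶ Q} {q : Q ⟶ R} {p' : P ⟶ Q'}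
    {q' : Q' ⟶ R} {c : Q ⟶ B} {c' : Q' ⟶ B'} {d : R ⟶ D} (h₁ : a ≫ f = p ≫ c)
    (h₂ : c ≫ g = q ≫ d) (h₃ : a ≫ f' = p' ≫ c') (h₄ : c' ≫ g' = q' ≫ d)
    (h : p ≫ q = p' ≫ q') : a ≫ f ≫ g = a ≫ f' ≫ g' := by
  rw [reassoc_of% h₁, h₂, reassoc_of% h, ← h₄, ← reassoc_of% h₃]

/-! ### The canonical morphisms between blow-ups, as maps induced by graded algebras. -/

section BlowupMaps
open GradedAlg
variable {X Y M : Scheme.{u}} (y : Y ⟶ X)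

/-- The map `Sym → Rees` of graded algebras. -/
def symToReesAlong (J : X.IdealSheafData) : HomAlong (𝟙 X) (reesAlg J) (symAlg J) where
  p := id
  p_mono := monotone_id
  p_eq := fun _ => rfl
  φ := fun U => symToRees (idealOf J U)
  φ_res := fun h => symToRees_symMap _ (ideal_le_comap J h)
  irrelevant_le := fun U => irrelevant_le_of_surjective _ (symToRees_surjective (idealOf J U))

/-- Gives access to the general results on `HomAlong.map`, in particular the description on charts.
-/
lemma blToSBl_eq_map (J : X.IdealSheafData) : blToSBl J = (symToReesAlong J).map := rfl

/-- The map of symmetric algebras of a closed immersion. -/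
def symPullAlong [QuasiCompact y] (i : X ⟶ M) [IsClosedImmersion i] :
    HomAlong i (symAlg y.ker) (symAlg (y ≫ i).ker) where
  p := preim i
  p_mono := preim_mono i
  p_eq := fun _ => rfl
  φ := fun V => symPull y i V
  φ_res := fun h => symPull_res y i h
  irrelevant_le := fun V => irrelevant_le_of_surjective _ (symPull_surjective y i V)

lemma sBlMap_eq_map [QuasiCompact y] (i : X ⟶ M) [IsClosedImmersion i] :
    sBlMap y i = (symPullAlong y i).map := rfl

lemma appLE_id_apply (U : X.AffineZariskiSite) (h : U.1 ≤ (𝟙 X) ⁻¹ᵁ U.1) (r : Γ(X, U.1)) :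
    (Scheme.Hom.appLE (𝟙 X) U.1 U.1 h).hom r = r :=
  congr(($((Scheme.Hom.appLE_eq_app (𝟙 X)).trans (Scheme.Hom.id_app U.1))).hom r)

lemma appLE_preim_apply (i : X ⟶ M) [IsAffineHom i] (V : M.AffineZariskiSite)
    (h : (preim i V).1 ≤ i ⁻¹ᵁ V.1) (r : Γ(M, V.1)) :
    (i.appLE V.1 (preim i V).1 h).hom r = sectionMap i V r :=
  congr(($(Scheme.Hom.appLE_eq_app i)).hom r)

end BlowupMaps

/-! ### Embedding of the quasi-symmetric blow-up in the blow-up of a smooth ambient scheme. -/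

section QSymMaps
open GradedAlg HomogeneousIdeal
variable {k : Type u} [Field k] {X Y M : Scheme.{u}} (s : X ⟶ Spec (.of k)) (y : Y ⟶ X)
  [QuasiCompact y]

/-- The map from the symmetric algebra to the quasi-symmetric algebra. -/
def symToQSymAlong (h : ∀ U, irrelevant ((qSymAlg s y).gr U) ≤
    (irrelevant ((symAlg y.ker).gr U)).map (symToQSym s y U)) :
    HomAlong (𝟙 X) (qSymAlg s y) (symAlg y.ker) where
  p := id
  p_mono := monotone_id
  p_eq := fun _ => rfl
  φ := fun U => symToQSym s y U
  φ_res := fun h => toLimQuot_res (embeddingKernels s y) h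
  irrelevant_le := h

lemma qBlToSBl_eq_map [(qSymAlg s y).IsQuasiCoherent] (h) :
    qBlToSBl s y h = (symToQSymAlong s y h).map := rfl

lemma symToQSymAlong_isAlgebraHom [(qSymAlg s y).IsQuasiCoherent] (h) :
    (symToQSymAlong s y h).IsAlgebraHom := by
  intro U r
  exact (toLimQuot_algebraMap (embeddingKernels s y) U r).trans
    (congrArg _ (appLE_id_apply U _ r).symm)

variable {s} {t : M ⟶ Spec (.of k)} {i : X ⟶ M} [Smooth t] [QuasiCompact t] [IsClosedImmersion i]
  (e : i ≫ t = s)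
include e

/-- A relation over the smooth `M` restricts to an element of `qSymKernel`, hence of `qSymKer`,
which is what the limit divides out. This is the condition for `Sym → qSym` to descend to the Rees
algebra. -/
lemma symToQSym_symPull_eq_zero (V : M.AffineZariskiSite) (b : (symAlg (y ≫ i).ker).obj V)
    (hb : symToRees (idealOf (y ≫ i).ker V) b = 0) :
    ((symToQSym s y (preim i V)).comp (symPull y i V)) b = 0 := by
  refine toLimQuot_eq_zero_of_decompose (qSymKer_mem_embeddingKernels s y e)
    (qSymKer_le_of_mem_embeddingKernels s y e) fun d => ?_
  refine qSymKernel_le_qSymKer_preim y i (t := t) V ?_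
  rw [qSymKernel_eq_map]
  refine Set.mem_of_eq_of_mem
    (GradedRingHom.map_directSumDecompose (f := symPull y i V) (x := b) (i := d)).symm ?_
  exact Ideal.mem_map_of_mem (symPull y i V).toRingHom (decompose_mem_relIdeal hb d)

/-- For a smooth ambient scheme `M`, the map from the Rees algebra of `Y` in `M` to the
quasi-symmetric algebra of `Y` in `X`. -/
def reesToQSym (V : M.AffineZariskiSite) :
    (reesAlg (y ≫ i).ker).gr V →+*ᵍ (qSymAlg s y).gr (preim i V) :=
  gradedDesc (𝒜 := (symAlg (y ≫ i).ker).gr V) (symToRees (idealOf (y ≫ i).ker V))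
    (symToRees_surjective _) ((symToQSym s y (preim i V)).comp (symPull y i V))
    (symToQSym_symPull_eq_zero y e V)

lemma reesToQSym_symToRees (V : M.AffineZariskiSite) (b : (symAlg (y ≫ i).ker).obj V) :
    reesToQSym y e V (symToRees (idealOf (y ≫ i).ker V) b) =
      symToQSym s y (preim i V) (symPull y i V b) :=
  gradedDesc_apply (𝒜 := (symAlg (y ≫ i).ker).gr V) (symToRees (idealOf (y ≫ i).ker V))
    (symToRees_surjective _) ((symToQSym s y (preim i V)).comp (symPull y i V))
    (symToQSym_symPull_eq_zero y e V) b

lemma reesToQSym_surjective (V : M.AffineZariskiSite) :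
    Function.Surjective (reesToQSym y e V) := by
  intro z
  obtain ⟨a, rfl⟩ := symToQSym_surjective s y e _ z
  obtain ⟨b, rfl⟩ := symPull_surjective y i V a
  exact ⟨_, reesToQSym_symToRees y e V b⟩

lemma reesToQSym_res {V V' : M.AffineZariskiSite} (h : V ≤ V') :
    (reesToQSym y e V).comp ((reesAlg (y ≫ i).ker).res h) =
      ((qSymAlg s y).res (preim_mono i h)).comp (reesToQSym y e V') := by
  refine GradedRingHom.ext fun z => ?_
  obtain ⟨b, rfl⟩ := symToRees_surjective (idealOf (y ≫ i).ker V') z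
  have h1 : (reesAlg (y ≫ i).ker).res h (symToRees (idealOf (y ≫ i).ker V') b) =
      symToRees (idealOf (y ≫ i).ker V) ((symAlg (y ≫ i).ker).res h b) :=
    (symToRees_symMap_apply _ (ideal_le_comap (y ≫ i).ker h) b).symm
  have h2 := reesToQSym_symToRees y e V ((symAlg (y ≫ i).ker).res h b)
  have h3 := reesToQSym_symToRees y e V' b
  have h4 : symPull y i V ((symAlg (y ≫ i).ker).res h b) =
      (symAlg y.ker).res (preim_mono i h) (symPull y i V' b) := congr($(symPull_res y i h) b)
  have h5 := res_toLimQuot (embeddingKernels s y) (preim_mono i h) (symPull y i V' b)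
  refine (congrArg _ h1).trans (h2.trans ((congrArg _ h4).trans ?_))
  exact h5.symm.trans (congrArg _ h3.symm)

/-- The map of graded algebras from the Rees algebra of `Y` in a smooth ambient scheme. -/
def reesToQSymAlong : HomAlong i (qSymAlg s y) (reesAlg (y ≫ i).ker) where
  p := preim i
  p_mono := preim_mono i
  p_eq := fun _ => rfl
  φ := fun V => reesToQSym y e V
  φ_res := fun h => reesToQSym_res y e h
  irrelevant_le := fun V => irrelevant_le_of_surjective _ (reesToQSym_surjective y e V)

lemma reesToQSymAlong_isAlgebraHom [(qSymAlg s y).IsQuasiCoherent] :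
    (reesToQSymAlong y e).IsAlgebraHom := by
  intro V r
  have h1 := reesToQSym_symToRees y e V (algebraMap _ _ r)
  have h2 : symPull y i V (algebraMap _ _ r) = algebraMap _ _ (sectionMap i V r) :=
    symMap_algebraMap _ (ideal_le_comap_sectionMap y i V) r
  have h3 := toLimQuot_algebraMap (embeddingKernels s y) (preim i V) (sectionMap i V r)
  refine (congrArg _ (symToRees_algebraMap r).symm).trans (h1.trans ((congrArg _ h2).trans ?_))
  exact h3.trans (congrArg _ (appLE_preim_apply i V _ r).symm)

/-- On each chart both composites are the Proj of the same graded map `Sym_M → qSym`, by the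
construction of `reesToQSym`. -/
lemma reesToQSymAlong_map_blToSBl [(qSymAlg s y).IsQuasiCoherent] (h) :
    (reesToQSymAlong y e).map ≫ blToSBl (y ≫ i).ker = qBlToSBl s y h ≫ sBlMap y i := by
  rw [blToSBl_eq_map, qBlToSBl_eq_map, sBlMap_eq_map]
  refine HomAlong.hom_ext_chart (Φ := reesToQSymAlong y e) fun V => ?_
  have h1 := (reesToQSymAlong y e).chart_map V
  have h2 := (symToReesAlong (y ≫ i).ker).chart_map V
  have h3 := (symToQSymAlong s y h).chart_map (preim i V)
  have h4 := (symPullAlong y i).chart_map V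
  have h5 : ((reesToQSymAlong y e).φ V).comp ((symToReesAlong (y ≫ i).ker).φ V) =
      ((symToQSymAlong s y h).φ (preim i V)).comp ((symPullAlong y i).φ V) :=
    GradedRingHom.ext fun b => reesToQSym_symToRees y e V b
  have h6 : Proj.map ((reesToQSymAlong y e).φ V) ((reesToQSymAlong y e).irrelevant_le V) ≫
      Proj.map ((symToReesAlong (y ≫ i).ker).φ V) ((symToReesAlong (y ≫ i).ker).irrelevant_le V) =
      Proj.map ((symToQSymAlong s y h).φ (preim i V))
        ((symToQSymAlong s y h).irrelevant_le (preim i V)) ≫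
      Proj.map ((symPullAlong y i).φ V) ((symPullAlong y i).irrelevant_le V) := by
    exact (Proj.map_comp _ _ _ _).symm.trans ((projMap_congr h5 _ _).trans (Proj.map_comp _ _ _ _))
  exact comp_eq_comp_of_squares h1 h2 h3 h4 h6

/-- The quasi-symmetric blow-up embeds in the blow-up of a smooth ambient scheme. -/
theorem admitsEmbedding_qBlToSBl [(qSymAlg s y).IsQuasiCoherent] (h) :
    AdmitsEmbedding s y (qBlToSBl s y h) := by
  have h1 := HomAlong.isClosedImmersion_map (reesToQSymAlong_isAlgebraHom y e)
    (reesToQSym_surjective y e)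
  refine ⟨M, t, i, inferInstance, inferInstance, inferInstance, (reesToQSymAlong y e).map, e,
    inferInstance, ?_, reesToQSymAlong_map_blToSBl y e h⟩
  rw [HomAlong.map_proj (reesToQSymAlong_isAlgebraHom y e), ← Category.assoc, qBlToSBl_eq_map,
    HomAlong.map_proj (symToQSymAlong_isAlgebraHom s y h), Category.comp_id]

end QSymMaps
-- Maximality of the quasi-symmetric blow-up.
lemma comp_eq_comp_of_mono {C : Type*} [Category C] {U Z A A' S B D P : C} {m : P ⟶ D} [Mono m]
    {c : A ⟶ S} {r : S ⟶ D} {p : A ⟶ P} {c' : A' ⟶ B} {b : B ⟶ D} {p' : A' ⟶ P} {f : U ⟶ A}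
    {f' : U ⟶ A'} {j : U ⟶ Z} {z : Z ⟶ S} {e : Z ⟶ B} (h₁ : c ≫ r = p ≫ m)
    (h₂ : c' ≫ b = p' ≫ m) (h₃ : f ≫ c = j ≫ z) (h₄ : f' ≫ c' = j ≫ e)
    (h₅ : e ≫ b = z ≫ r) : f ≫ p = f' ≫ p' := by
  rw [← cancel_mono m, Category.assoc, Category.assoc, ← h₁, ← h₂, reassoc_of% h₃, reassoc_of% h₄,
    h₅]

lemma comp_eq_of_squares {C : Type*} [Category C] {U Z A P S Q : C} {c : P ⟶ S} {q : A ⟶ Q}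
    {b : Q ⟶ S} {p : A ⟶ P} {g : U ⟶ A} {f : U ⟶ P} {j : U ⟶ Z} {z : Z ⟶ S}
    (h₁ : q ≫ b = p ≫ c) (h₂ : g ≫ p = f) (h₃ : f ≫ c = j ≫ z) : (g ≫ q) ≫ b = j ≫ z := by
  rw [Category.assoc, h₁, reassoc_of% h₂, h₃]

section Maximality
open GradedAlg HomogeneousIdeal Limits
variable {k : Type u} [Field k] {X Y M M₀ : Scheme.{u}} {s : X ⟶ Spec (.of k)} (y : Y ⟶ X)
  [QuasiCompact y] {t₀ : M₀ ⟶ Spec (.of k)} {i₀ : X ⟶ M₀} [Smooth t₀] [QuasiCompact t₀]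
  [IsClosedImmersion i₀] (h₀ : i₀ ≫ t₀ = s)
include h₀

/-- The kernel for the smooth `M₀` lies in the kernel for `M`, which is the image of the relations
over `V` because `symPull` is surjective. Taking the degree `d` component makes the lifted relation
homogeneous. This is hypothesis `H` of `exists_factorization_projMap`. -/
lemma exists_relation_of_symToQSym_eq_zero {t : M ⟶ Spec (.of k)} {i : X ⟶ M}
    [LocallyOfFiniteType t] [IsClosedImmersion i] (h : i ≫ t = s) (V : M.AffineZariskiSite) (d : ℕ)
    (a) (ha : a ∈ (symAlg y.ker).gr (preim i V) d) (ha' : symToQSym s y (preim i V) a = 0) :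
    ∃ b ∈ (symAlg (y ≫ i).ker).gr V d, symPull y i V b = a ∧
      symToRees (idealOf (y ≫ i).ker V) b = 0 := by
  have h1 := qSymKer_preim_le y i V (qSymKer_le_of_smooth y i i₀ (h₀.trans h.symm) _
    ((symToQSym_eq_zero_iff s y h₀ ha).mp ha'))
  rw [qSymKernel_eq_map] at h1
  obtain ⟨b, hb, hba⟩ := (Ideal.mem_map_iff_of_surjective (symPull y i V).toRingHom
    (symPull_surjective y i V)).mp h1
  refine ⟨DirectSum.decompose ((symAlg (y ≫ i).ker).gr V) b d, Subtype.prop _, ?_,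
    decompose_mem_relIdeal hb d⟩
  rw [GradedRingHom.map_directSumDecompose]
  have : symPull y i V b = a := hba
  rw [this, DirectSum.decompose_of_mem_same _ ha]

/-- A subscheme of the symmetric blow-up which embeds in a blow-up of an ambient scheme is
contained in the quasi-symmetric blow-up. -/
theorem exists_factorization_of_admitsEmbedding [(qSymAlg s y).IsQuasiCoherent] (h)
    {Z : Scheme.{u}} (ι : Z ⟶ sBl y.ker) (hι : AdmitsEmbedding s y ι) :
    ∃ g : Z ⟶ qBl s y, g ≫ qBlToSBl s y h = ι := by
  obtain ⟨M, t, i, _, _, _, e, hit, -, he, he'⟩ := hι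
  have hcl : IsClosedImmersion (qBlToSBl s y h) :=
    HomAlong.isClosedImmersion_map (symToQSymAlong_isAlgebraHom s y h)
      (symToQSym_surjective s y h₀)
  refine exists_factorization_of_local _ ι fun z => ?_
  obtain ⟨V, hV⟩ := exists_affineZariskiSite_mem (((symAlg y.ker).proj ≫ i) (ι z))
  let c := (symAlg y.ker).chart (preim i V)
  let c' := (reesAlg (y ≫ i).ker).chart V
  have hc : c.opensRange = (symAlg y.ker).proj ⁻¹ᵁ i ⁻¹ᵁ V.1 := opensRange_chart _
  have hc' : c'.opensRange = (reesAlg (y ≫ i).ker).proj ⁻¹ᵁ V.1 := opensRange_chart _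
  let U : Z.Opens := ι ⁻¹ᵁ c.opensRange
  -- Both charts are the parts over `V`, and `ι` and `e` agree after projection to `M`, so the same
  -- open of `Z` lands in both.
  have hU : U = e ⁻¹ᵁ c'.opensRange := by
    rw [hc', ← Scheme.Hom.comp_preimage, he, Scheme.Hom.comp_preimage, Scheme.Hom.comp_preimage,
      ← hc]
  have hr : Set.range (U.ι ≫ ι) ⊆ Set.range c := by
    rintro _ ⟨x, rfl⟩
    exact x.2
  have hr' : Set.range (U.ι ≫ e) ⊆ Set.range c' := by
    rintro _ ⟨x, rfl⟩
    have hx : x.1 ∈ e ⁻¹ᵁ c'.opensRange := by rw [← hU]; exact x.2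
    exact hx
  obtain ⟨f, hf⟩ : ∃ f, f ≫ c = U.ι ≫ ι := ⟨_, IsOpenImmersion.lift_fac _ _ hr⟩
  obtain ⟨f', hf'⟩ : ∃ f', f' ≫ c' = U.ι ≫ e := ⟨_, IsOpenImmersion.lift_fac _ _ hr'⟩
  have h1 : c ≫ sBlMap y i = Proj.map (symPull y i V) ((symPullAlong y i).irrelevant_le V) ≫
    (symAlg (y ≫ i).ker).chart V := (symPullAlong y i).chart_map V
  have h2 : c' ≫ blToSBl (y ≫ i).ker = Proj.map (symToRees (idealOf (y ≫ i).ker V))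
    ((symToReesAlong (y ≫ i).ker).irrelevant_le V) ≫ (symAlg (y ≫ i).ker).chart V :=
    (symToReesAlong (y ≫ i).ker).chart_map V
  have h3 : (qSymAlg s y).chart (preim i V) ≫ qBlToSBl s y h =
      Proj.map (symToQSym s y (preim i V)) (h (preim i V)) ≫ c :=
    (symToQSymAlong s y h).chart_map (preim i V)
  -- The agreement in `sBl_Y M` descends to the chart `Proj Sym_M(V)`, whose inclusion is a
  -- monomorphism.
  have w : f ≫ Proj.map (symPull y i V) ((symPullAlong y i).irrelevant_le V) =
      f' ≫ Proj.map (symToRees (idealOf (y ≫ i).ker V))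
        ((symToReesAlong (y ≫ i).ker).irrelevant_le V) :=
    comp_eq_comp_of_mono h1 h2 hf hf' he'
  obtain ⟨g, hg⟩ := exists_factorization_projMap (symPull y i V)
    (symToRees (idealOf (y ≫ i).ker V)) (symToQSym s y (preim i V))
    (symToQSym_surjective s y h₀ _) (exists_relation_of_symToQSym_eq_zero y h₀ hit V)
    ((symPullAlong y i).irrelevant_le V) ((symToReesAlong (y ≫ i).ker).irrelevant_le V)
    (h (preim i V)) f f' w
  refine ⟨U, U.ι, inferInstance, g ≫ (qSymAlg s y).chart (preim i V), ?_, ?_⟩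
  · rw [Scheme.Opens.range_ι]
    change ι z ∈ c.opensRange
    rw [hc]
    exact hV
  · exact comp_eq_of_squares h3 hg hf

end Maximality

end QSym
end

/-! ### The corollary. -/

theorem mainTheorem6 {k : Type u} [Field k] {X Y : Scheme.{u}} (s : X ⟶ Spec (.of k))
    [LocallyOfFiniteType s] [QuasiCompact s] (y : Y ⟶ X) [IsClosedImmersion y]
    (hX : ∃ (M : Scheme.{u}) (t : M ⟶ Spec (.of k)) (i : X ⟶ M),
      Smooth t ∧ QuasiCompact t ∧ IsClosedImmersion i ∧ i ≫ t = s) :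
    ∃ (_ : (QSym.qSymAlg s y).IsQuasiCoherent)
      (h : ∀ U, HomogeneousIdeal.irrelevant ((QSym.qSymAlg s y).gr U) ≤
        (HomogeneousIdeal.irrelevant ((QSym.symAlg y.ker).gr U)).map (QSym.symToQSym s y U)),
      IsClosedImmersion (QSym.qBlToSBl s y h) ∧
      QSym.AdmitsEmbedding s y (QSym.qBlToSBl s y h) ∧
      ∀ (Z : Scheme.{u}) (ι : Z ⟶ QSym.sBl y.ker), IsImmersion ι →
        QSym.AdmitsEmbedding s y ι → ∃ g : Z ⟶ QSym.qBl s y, g ≫ QSym.qBlToSBl s y h = ι := by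
  obtain ⟨M, t, i, _, _, _, e⟩ := hX
  have hq := QSym.qSymAlg_isQuasiCoherent s y e
  have h := fun U => QSym.GradedAlg.irrelevant_le_of_surjective (QSym.symToQSym s y U)
    (QSym.symToQSym_surjective s y e U)
  exact ⟨hq, h, QSym.GradedAlg.HomAlong.isClosedImmersion_map
      (QSym.symToQSymAlong_isAlgebraHom s y h) (QSym.symToQSym_surjective s y e),
    QSym.admitsEmbedding_qBlToSBl y e h,
    fun Z ι _ hι => QSym.exists_factorization_of_admitsEmbedding y e h ι hι⟩
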